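/- Let $n,p,q,s,J\ge 0$ and $m_1,\dots,m_J\ge 1$ be integers, $m=\sum_i m_i$, and let $\mathcal K=\mathcal K_1\times\dots\times\mathcal K_J\subset\mathbb R^m$, where $\mathcal K_i=\{(x_1,x_2)\in\mathbb R\times\mathbb R^{m_i-1}: x_1\ge\|x_2\|\}$. Let $g:\mathbb R^n\to\mathbb R^p$, $h:\mathbb R^n\to\mathbb R^q$, $\varphi,\psi:\mathbb R^n\to\mathbb R^s$ and $G,H:\mathbb R^n\to\mathbb R^m$ be continuously differentiable, write $G=(G_1,\dots,G_J)$, $H=(H_1,\dots,H_J)$ in blocks, and let $\mathcal F$ be the set of all $z\in\mathbb R^n$ with $$\mathcal K\ni G(z)\perp H(z)\in\mathcal K,\qquad \text{(CS)}\quad g(z)\le 0,\ h(z)=0,\ 0\le\varphi(z)\perp\psi(z)\ge 0 .$$ Put $\Omega_i=\{(x,y): \mathcal K_i\ni x\perp y\in\mathcal K_i\}\subset\mathbb R^{m_i}\times\mathbb R^{m_i}$, $\Theta=\{(a,b)\in\mathbb R^2: a\ge0,\ b\ge0,\ ab=0\}$ and $\Theta^s=\{(a,b)\in\mathbb R^{s}\times\mathbb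 R^s: a\ge0,\ b\ge0,\ a^Tb=0\}$. All norms are Euclidean, $d(\cdot,C)=d_C(\cdot)$ is the distance to $C$, $\nabla$ denotes the Jacobian, and $g_+=\max\{0,g\}$ componentwise. For a set $C$ in a Euclidean space, let $T_C(z)=\{u:\exists\,t_k\downarrow0,\ u_k\to u,\ z+t_ku_k\in C\ \forall k\}$ for $z\in C$; let $\widehat N_C(z)=\{v:\langle v,z'-z\rangle\le o(\|z'-z\|)\text{ for } z'\in C\}$ for $z\in C$ and $\widehat N_C(z)=\emptyset$ for $z\notin C$; let $N_C(z)=\{\lim v_k: v_k\in\widehat N_C(z_k),\ z_k\to z\}$ be the limiting normal cone, and $N_C(z;d)=\{\lim v_k: v_k\in\widehat N_C(z+t_kd_k),\ t_k\downarrow0,\ d_k\to d\}$ the limiting normal cone in direction $d$. Let $z^*\in\mathcal F$, let $I_g=\{i:g_i(z^*)=0\}$, and define $I_\varphi,I_\psi$ likewise. Let $\mathcal L(z^*)$ be the set of all $w\in\mathbb R^n$ such that $\nabla g_i(z^*)w\le0$ for $i\in I_g$; $\nabla h_i(z^*)w=0$ for all $i$; $\nabla\varphi_i(z^*)w=0$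 for $i\notin I_\psi$; $\nabla\psi_i(z^*)w=0$ for $i\notin I_\varphi$; $0\le\nabla\varphi_i(z^*)w\perp\nabla\psi_i(z^*)w\ge0$ for $i\in I_\varphi\cap I_\psi$; and $(\nabla G_i(z^*)w,\nabla H_i(z^*)w)\in T_{\Omega_i}(G_i(z^*),H_i(z^*))$ for $i=1,\dots,J$. Suppose that (CS) is metrically subregular at $z^*$: with $P=(g,h,\varphi,\psi)$ and $D=\mathbb R^p_-\times\{0\}^q\times\Theta^s$ there are a constant $c>0$ and a neighborhood $V$ of $z^*$ with $d(z,P^{-1}(D))\le c\,d_D(P(z))$ for all $z\in V$. Suppose moreover that either $\mathcal L(z^*)=\{0\}$, or $\mathcal L(z^*)\ne\{0\}$ and for every $0\ne w\in\mathcal L(z^*)$ and all $\lambda^g\in\mathbb R^p$, $\lambda^h\in\mathbb R^q$, $\lambda^\varphi,\lambda^\psi\in\mathbb R^s$, $\lambda^G,\lambda^H\in\mathbb R^m$ the conditions $$\begin{aligned} &\nabla g(z^*)^T\lambda^g+\nabla h(z^*)^T\lambda^h+\nabla\varphi(z^*)^T\lambda^\varphi+\nabla\psi(z^*)^T\lambda^\psi+\nabla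 G(z^*)^T\lambda^G+\nabla H(z^*)^T\lambda^H=0,\\ &\lambda^g\ge0,\quad \lambda^g_i=0\ (i\notin I_g),\quad \lambda^\varphi_i=0\ (i\notin I_\varphi),\quad \lambda^\psi_i=0\ (i\notin I_\psi),\\ &(\lambda^\varphi_i,\lambda^\psi_i)\in N_\Theta(\nabla\varphi_i(z^*)w,\nabla\psi_i(z^*)w)\quad (i\in I_\varphi\cap I_\psi),\\ &(\lambda^G_i,\lambda^H_i)\in N_{\Omega_i}\big((G_i(z^*),H_i(z^*));(\nabla G_i(z^*)w,\nabla H_i(z^*)w)\big)\quad (i=1,\dots,J) \end{aligned}$$ imply $(\lambda^G,\lambda^H)=0$. Then the system has a local error bound at $z^*$: there are $\kappa>0$ and $\delta>0$ such that for all $z$ with $\|z-z^*\|<\delta$, $$d(z,\mathcal F)\le\kappa\Big\{\|h(z)\|+\|g_+(z)\|+\sum_{i=1}^s d_\Theta(\varphi_i(z),\psi_i(z))+\sum_{i=1}^J d_{\Omega_i}(G_i(z),H_i(z))\Big\}.$$ -/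

import Mathlib

open Filter Topology

/-! ### Variational analysis -/

section Variational

variable {E : Type*} [NormedAddCommGroup E] [InnerProductSpace ℝ E]

/-- The tangent (Bouligand) cone of `C` at `z`: all `u` for which there are `t_k ↓ 0` and `u_k → u`
with `z + t_k u_k ∈ C` for all `k`. -/
def tangentConeB (C : Set E) (z : E) : Set E :=
  {u | ∃ (t : ℕ → ℝ) (d : ℕ → E), (∀ k, 0 < t k) ∧ Tendsto t atTop (𝓝 0) ∧
    Tendsto d atTop (𝓝 u) ∧ ∀ k, z + t k • d k ∈ C}

/-- The regular (Fréchet) normal cone of `C` at `z`: all `v` with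
`⟨v, z' - z⟩ ≤ o(‖z' - z‖)` for `z' ∈ C`. It is empty at points outside `C`. -/
def regularNormalCone (C : Set E) (z : E) : Set E :=
  {v | z ∈ C ∧ ∀ ε : ℝ, 0 < ε → ∀ᶠ z' in 𝓝[C] z, inner ℝ v (z' - z) ≤ ε * ‖z' - z‖}

/-- The limiting (Mordukhovich) normal cone of `C` at `z`. The base points `z_k` lie in `C`
because the regular normal cone is empty elsewhere. -/
def limitingNormalCone (C : Set E) (z : E) : Set E :=
  {v | ∃ (x : ℕ → E) (y : ℕ → E), Tendsto x atTop (𝓝 z) ∧ Tendsto y atTop (𝓝 v) ∧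
    ∀ k, y k ∈ regularNormalCone C (x k)}

/-- The limiting normal cone of `C` at `z` in direction `d`: all limits of
`v_k ∈ N̂_C(z + t_k d_k)` with `t_k ↓ 0` and `d_k → d`. -/
def directionalNormalCone (C : Set E) (z d : E) : Set E :=
  {v | ∃ (t : ℕ → ℝ) (e : ℕ → E) (y : ℕ → E), (∀ k, 0 < t k) ∧ Tendsto t atTop (𝓝 0) ∧
    Tendsto e atTop (𝓝 d) ∧ Tendsto y atTop (𝓝 v) ∧
    ∀ k, y k ∈ regularNormalCone C (z + t k • e k)}

/-- Metric subregularity at `(z, 0)` of the set-valued map `M(z) = P(z) - D`: `P z ∈ D`, and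
`d(z', M⁻¹(0)) ≤ κ d_D(P(z'))` for some `κ > 0` and all `z'` near `z`; here
`M⁻¹(0) = {z' | P(z') ∈ D}`. -/
def MetricallySubregularAt {F : Type*} [NormedAddCommGroup F]
    (P : E → F) (D : Set F) (z : E) : Prop :=
  P z ∈ D ∧ ∃ κ : ℝ, 0 < κ ∧ ∀ᶠ z' in 𝓝 z,
    Metric.infDist z' {x | P x ∈ D} ≤ κ * Metric.infDist (P z') D

end Variational

/-! ### Second-order cones and complementarity sets -/

/-- `ℝⁿ` with the Euclidean norm. -/
abbrev Euc (n : ℕ) : Type := EuclideanSpace ℝ (Fin n)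

/-- `ℝᵐ = ℝ^{m_1} × ⋯ × ℝ^{m_J}` with the Euclidean norm. The `i`-th block has dimension
`r i + 1`, so that every block has dimension at least one. -/
abbrev BlockSpace {J : ℕ} (r : Fin J → ℕ) : Type := PiLp 2 (fun i : Fin J => Euc (r i + 1))

/-- The second-order cone `{(x₁, x₂) ∈ ℝ × ℝʳ | ‖x₂‖ ≤ x₁}` in `ℝ^{r+1}`. -/
def secondOrderCone (r : ℕ) : Set (Euc (r + 1)) :=
  {x | ‖(WithLp.toLp 2 (fun j : Fin r => x j.succ) : Euc r)‖ ≤ x 0}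

/-- The product `𝒦 = 𝒦_1 × ⋯ × 𝒦_J` of second-order cones. -/
def productCone {J : ℕ} (r : Fin J → ℕ) : Set (BlockSpace r) :=
  {x | ∀ i, x i ∈ secondOrderCone (r i)}

/-- The second-order cone complementarity set `{(x, y) | 𝒦 ∋ x ⊥ y ∈ 𝒦}` in
`ℝ^{r+1} × ℝ^{r+1}`. -/
def socComplementaritySet (r : ℕ) : Set (WithLp 2 (Euc (r + 1) × Euc (r + 1))) :=
  {u | u.fst ∈ secondOrderCone r ∧ u.snd ∈ secondOrderCone r ∧ inner ℝ u.fst u.snd = 0}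

/-- The complementarity cone `Θ = {(a, b) ∈ ℝ² | a ≥ 0, b ≥ 0, a b = 0}`. -/
def complementarityCone : Set (WithLp 2 (ℝ × ℝ)) :=
  {u | 0 ≤ u.fst ∧ 0 ≤ u.snd ∧ u.fst * u.snd = 0}

/-- A pair as a point of the product space with the Euclidean norm. -/
abbrev l2pair {A B : Type*} (a : A) (b : B) : WithLp 2 (A × B) := WithLp.toLp 2 (a, b)

/-! ### The complementarity system -/

section System

variable {n p q s J : ℕ} {r : Fin J → ℕ}

/-- `ℝᵖ × ℝ^q × ℝˢ × ℝˢ` with the Euclidean norm. -/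
abbrev ConstraintSpace (p q s : ℕ) : Type :=
  WithLp 2 (Euc p × WithLp 2 (Euc q × WithLp 2 (Euc s × Euc s)))

/-- The map `z ↦ (g(z), h(z), φ(z), ψ(z))`. -/
def constraintMap (g : Euc n → Euc p) (h : Euc n → Euc q) (φ ψ : Euc n → Euc s) :
    Euc n → ConstraintSpace p q s :=
  fun z => l2pair (g z) (l2pair (h z) (l2pair (φ z) (ψ z)))

/-- The set `ℝ₋ᵖ × {0}^q × Θˢ`, where `Θˢ = {(a, b) | a ≥ 0, b ≥ 0, aᵀb = 0}`. -/
def constraintSet (p q s : ℕ) : Set (ConstraintSpace p q s) :=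
  {u | (∀ i, u.fst i ≤ 0) ∧ u.snd.fst = 0 ∧
    (∀ i, 0 ≤ u.snd.snd.fst i) ∧ (∀ i, 0 ≤ u.snd.snd.snd i) ∧
    inner ℝ u.snd.snd.fst u.snd.snd.snd = 0}

/-- The solution set of the system `𝒦 ∋ G(z) ⊥ H(z) ∈ 𝒦`, `g(z) ≤ 0`, `h(z) = 0`,
`0 ≤ φ(z) ⊥ ψ(z) ≥ 0`. -/
def solutionSet (g : Euc n → Euc p) (h : Euc n → Euc q) (φ ψ : Euc n → Euc s)
    (G H : Euc n → BlockSpace r) : Set (Euc n) :=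
  {z | (G z ∈ productCone r ∧ H z ∈ productCone r ∧ inner ℝ (G z) (H z) = 0) ∧
    (∀ i, g z i ≤ 0) ∧ h z = 0 ∧
    (∀ i, 0 ≤ φ z i) ∧ (∀ i, 0 ≤ ψ z i) ∧ inner ℝ (φ z) (ψ z) = 0}

/-- The linearized cone of the system at `z`. -/
def linearizedCone (g : Euc n → Euc p) (h : Euc n → Euc q) (φ ψ : Euc n → Euc s)
    (G H : Euc n → BlockSpace r) (z : Euc n) : Set (Euc n) :=
  {w | (∀ i, g z i = 0 → fderiv ℝ g z w i ≤ 0) ∧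
    (∀ i, fderiv ℝ h z w i = 0) ∧
    (∀ i, ψ z i ≠ 0 → fderiv ℝ φ z w i = 0) ∧
    (∀ i, φ z i ≠ 0 → fderiv ℝ ψ z w i = 0) ∧
    (∀ i, φ z i = 0 → ψ z i = 0 →
      0 ≤ fderiv ℝ φ z w i ∧ 0 ≤ fderiv ℝ ψ z w i ∧ fderiv ℝ φ z w i * fderiv ℝ ψ z w i = 0) ∧
    (∀ i, l2pair (fderiv ℝ G z w i) (fderiv ℝ H z w i) ∈
      tangentConeB (socComplementaritySet (r i)) (l2pair (G z i) (H z i)))}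

/-- `(lg, lh, lφ, lψ, lG, lH)` is a multiplier of the system at `z` in direction `w`. -/
def IsDirectionalMultiplier (g : Euc n → Euc p) (h : Euc n → Euc q) (φ ψ : Euc n → Euc s)
    (G H : Euc n → BlockSpace r) (z w : Euc n)
    (lg : Euc p) (lh : Euc q) (lφ lψ : Euc s) (lG lH : BlockSpace r) : Prop :=
  (fderiv ℝ g z).adjoint lg + (fderiv ℝ h z).adjoint lh +
    (fderiv ℝ φ z).adjoint lφ + (fderiv ℝ ψ z).adjoint lψ +
    (fderiv ℝ G z).adjoint lG + (fderiv ℝ H z).adjoint lH = 0 ∧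
  (∀ i, 0 ≤ lg i) ∧ (∀ i, g z i ≠ 0 → lg i = 0) ∧
  (∀ i, φ z i ≠ 0 → lφ i = 0) ∧ (∀ i, ψ z i ≠ 0 → lψ i = 0) ∧
  (∀ i, φ z i = 0 → ψ z i = 0 →
    l2pair (lφ i) (lψ i) ∈ limitingNormalCone complementarityCone
      (l2pair (fderiv ℝ φ z w i) (fderiv ℝ ψ z w i))) ∧
  (∀ i, l2pair (lG i) (lH i) ∈ directionalNormalCone (socComplementaritySet (r i))
      (l2pair (G z i) (H z i)) (l2pair (fderiv ℝ G z w i) (fderiv ℝ H z w i)))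

/-- The residual `‖h(z)‖ + ‖g₊(z)‖ + ∑ᵢ d_Θ(φᵢ(z), ψᵢ(z)) + ∑ᵢ d_{Ωᵢ}(Gᵢ(z), Hᵢ(z))`. -/
noncomputable def errorResidual (g : Euc n → Euc p) (h : Euc n → Euc q) (φ ψ : Euc n → Euc s)
    (G H : Euc n → BlockSpace r) (z : Euc n) : ℝ :=
  ‖h z‖ + ‖(WithLp.toLp 2 (fun i => max 0 (g z i)) : Euc p)‖ +
    ∑ i, Metric.infDist (l2pair (φ z i) (ψ z i)) complementarityCone +
    ∑ i, Metric.infDist (l2pair (G z i) (H z i)) (socComplementaritySet (r i))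

end System

/-! Argue by contradiction. Write the system as `P z ∈ D`, `Q z ∈ Ω` with `Q = (G, H)`, and let `F`
be its solution set; only the `P` part is assumed subregular. If the error bound fails, projecting
bad points onto `P⁻¹(D)` gives points `a` arbitrarily close to the reference point `zs` with `P a ∈
D` and `d_Ω(Q a) ≤ ε² d(a, F)` (`exists_infDist_le_mul_infDist`).

Minimize `d_Ω(Q z) + ε‖z - a‖ + j d_D(P z)²` over a fixed ball around `zs`. For large `j` the
minimizer stays close to `a`, still violates `Q z ∈ Ω`, and violates both constraints by at most
`ε‖z - zs‖`. Comparing it with its own projection onto `P⁻¹(D)`, subregularity bounds `j d_D(P z)`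
independently of `j` (`exists_penalized_minimizer`). The quadratic penalty is thus as good as an
exact one, and no nonsmooth sum rule is needed: replacing each distance by the distance to a fixed
nearest point gives a differentiable majorant, whose stationarity yields a unit regular normal `l`
to `Ω` and a bounded regular normal `m` to `D` with `‖∇Qᵀl + ∇Pᵀm‖ ≤ ε`.

As `ε → 0`, compactness gives limits of the unit directions `(z - zs)/‖z - zs‖`, of `l` and of `m`.
Since the violations are `o(‖z - zs‖)`, the limits `l ≠ 0` and `m` are normals in the directions `∇Q
w` and `∇P w`, with `w ≠ 0` (`exists_directional_multipliers`). A directional normal exists only in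
a tangent direction, so `w` lies in the linearized cone. Reading `l` and `m` componentwise gives a
multiplier with `(lG, lH) ≠ 0`, which the hypothesis forbids. -/

/-! ### Penalized distance functions -/

section Penalization

variable {E Y U : Type*} [NormedAddCommGroup E] [NormedAddCommGroup Y] [NormedAddCommGroup U]

/-- If the error bound fails, feasible points of the subregular part violate the rest
arbitrarily little relative to the distance to the solution set. -/
theorem exists_infDist_le_mul_infDist [ProperSpace E] {Q : E → Y} {P : E → U} {Ω : Set Y}
    {D : Set U} (hPc : Continuous P) (hD : IsClosed D) {zs : E} (hPzs : P zs ∈ D) (hQzs : Q zs ∈ Ω)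
    {c L ρ : ℝ} (hc : 0 < c) (hL : 0 ≤ L) (hρ : 0 < ρ)
    (hreg : ∀ z ∈ Metric.closedBall zs ρ,
      Metric.infDist z {x | P x ∈ D} ≤ c * Metric.infDist (P z) D)
    (hlip : ∀ z ∈ Metric.closedBall zs ρ, ∀ z' ∈ Metric.closedBall zs ρ,
      dist (Q z) (Q z') ≤ L * dist z z')
    (hfail : ∀ κ : ℝ, 0 < κ → ∀ δ : ℝ, 0 < δ → ∃ z ∈ Metric.ball zs δ,
      κ * (Metric.infDist (P z) D + Metric.infDist (Q z) Ω) <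
        Metric.infDist z {x | P x ∈ D ∧ Q x ∈ Ω})
    {ε δ : ℝ} (hε : 0 < ε) (hδ : 0 < δ) :
    ∃ a, P a ∈ D ∧ dist a zs < δ ∧ 0 < Metric.infDist a {x | P x ∈ D ∧ Q x ∈ Ω} ∧
      Metric.infDist (Q a) Ω ≤ ε * Metric.infDist a {x | P x ∈ D ∧ Q x ∈ Ω} := by
  set F := {x | P x ∈ D ∧ Q x ∈ Ω}
  have hzF : zs ∈ F := ⟨hPzs, hQzs⟩
  -- The first summand keeps the projection `a` at distance at least `d / 2` from `F`; the second
  -- makes the residual `y + L * c * x` at `a` at most `ε * d / 2`.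
  set K := 2 * c + 2 * (1 + L * c) / ε
  have hK : 0 < K := by positivity
  obtain ⟨z, hz, hlt⟩ := hfail K hK (min (δ / 2) (ρ / 2)) (by positivity)
  have hz1 : dist z zs < δ / 2 := (Metric.mem_ball.1 hz).trans_le (min_le_left _ _)
  have hz2 : dist z zs < ρ / 2 := (Metric.mem_ball.1 hz).trans_le (min_le_right _ _)
  obtain ⟨a, ha, hda⟩ := (hD.preimage hPc).exists_infDist_eq_dist ⟨zs, hPzs⟩ z
  have hzB : z ∈ Metric.closedBall zs ρ := Metric.mem_closedBall.2 (by linarith)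
  have h1 : dist z a ≤ c * Metric.infDist (P z) D := hda ▸ hreg z hzB
  have h2 : dist z a ≤ dist z zs := hda ▸ Metric.infDist_le_dist_of_mem hPzs
  have h3 : dist a zs ≤ dist z a + dist z zs := by
    rw [dist_comm z a]; exact dist_triangle _ _ _
  have haB : a ∈ Metric.closedBall zs ρ := Metric.mem_closedBall.2 (by linarith)
  have h4 : Metric.infDist (Q a) Ω ≤ Metric.infDist (Q z) Ω + L * dist z a := by
    have := Metric.infDist_le_infDist_add_dist (s := Ω) (x := Q a) (y := Q z)
    have := hlip a haB z hzB
    rw [dist_comm a z] at this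
    linarith
  have h5 : Metric.infDist z F ≤ Metric.infDist a F + dist z a :=
    Metric.infDist_le_infDist_add_dist
  have n1 : 0 ≤ Metric.infDist (P z) D := Metric.infDist_nonneg
  have n2 : 0 ≤ Metric.infDist (Q z) Ω := Metric.infDist_nonneg
  set x := Metric.infDist (P z) D
  set y := Metric.infDist (Q z) Ω
  set d := Metric.infDist z F
  have e1 : 2 * c * (x + y) ≤ K * (x + y) :=
    mul_le_mul_of_nonneg_right (le_add_of_nonneg_right (by positivity)) (by positivity)
  have e2 : 2 * (1 + L * c) / ε * (x + y) ≤ K * (x + y) :=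
    mul_le_mul_of_nonneg_right (le_add_of_nonneg_left (by positivity)) (by positivity)
  have e3 : 2 * (1 + L * c) * (x + y) ≤ ε * d := by
    have : 2 * (1 + L * c) / ε * (x + y) ≤ d := by linarith
    rw [div_mul_eq_mul_div, div_le_iff₀ hε] at this
    linarith
  have h6 : d / 2 ≤ Metric.infDist a F := by nlinarith [mul_nonneg hc.le n2]
  have hd : 0 < d := lt_of_le_of_lt (by positivity) hlt
  refine ⟨a, ha, by linarith, by linarith, ?_⟩
  have e4 : L * dist z a ≤ L * (c * x) := mul_le_mul_of_nonneg_left h1 hL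
  have e5 : 0 ≤ L * c * y := by positivity
  nlinarith [mul_le_mul_of_nonneg_left h6 hε.le]

/-- A minimizer of the penalized distance function close to an almost feasible point `a`. -/
theorem exists_penalized_minimizer [ProperSpace E] {Q : E → Y} {P : E → U} {Ω : Set Y}
    {D : Set U} (hQ : Continuous Q) (hP : Continuous P) (hΩ : IsClosed Ω)
    (hD : IsClosed D) {zs : E} (hPzs : P zs ∈ D) (hQzs : Q zs ∈ Ω)
    {c L ρ : ℝ} (hc : 0 < c) (hL : 0 ≤ L) (hρ : 0 < ρ)
    (hreg : ∀ z ∈ Metric.closedBall zs ρ,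
      Metric.infDist z {x | P x ∈ D} ≤ c * Metric.infDist (P z) D)
    (hlip : ∀ z ∈ Metric.closedBall zs ρ, ∀ z' ∈ Metric.closedBall zs ρ,
      dist (Q z) (Q z') ≤ L * dist z z')
    {ε : ℝ} (hε : 0 < ε) (hε2 : ε ≤ 1 / 2) {a : E} (ha : P a ∈ D) (haρ : dist a zs < ρ / 4)
    (hd : 0 < Metric.infDist a {x | P x ∈ D ∧ Q x ∈ Ω})
    (hQaΩ : Metric.infDist (Q a) Ω ≤ ε ^ 2 * Metric.infDist a {x | P x ∈ D ∧ Q x ∈ Ω}) :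
    ∃ (z : E) (j : ℝ), 0 < j ∧ z ≠ zs ∧ dist z zs ≤ 2 * dist a zs ∧
      0 < Metric.infDist (Q z) Ω ∧ Metric.infDist (Q z) Ω ≤ ε * dist z zs ∧
      Metric.infDist (P z) D ≤ ε * dist z zs ∧ j * Metric.infDist (P z) D ≤ (L + 1) * c ∧
      ∀ᶠ z' in 𝓝 z, Metric.infDist (Q z) Ω + j * Metric.infDist (P z) D ^ 2 ≤
        Metric.infDist (Q z') Ω + j * Metric.infDist (P z') D ^ 2 + ε * dist z' z := by
  set F := {x | P x ∈ D ∧ Q x ∈ Ω}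
  set d := Metric.infDist a F
  have hzF : zs ∈ F := ⟨hPzs, hQzs⟩
  have hda : d ≤ dist a zs := Metric.infDist_le_dist_of_mem hzF
  have cQ : Continuous fun z => Metric.infDist (Q z) Ω :=
    (Metric.continuous_infDist_pt Ω).comp hQ
  have cP : Continuous fun z => Metric.infDist (P z) D :=
    (Metric.continuous_infDist_pt D).comp hP
  -- a positive lower bound of the residual near `a`
  obtain ⟨b, hb, hbmin⟩ := (isCompact_closedBall a (ε * d)).exists_isMinOn
    ⟨a, Metric.mem_closedBall_self (by positivity)⟩ (cQ.add cP).continuousOn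
  have hbF : b ∉ F := fun hbF => by
    have h1 : d ≤ dist a b := Metric.infDist_le_dist_of_mem hbF
    have h2 := Metric.mem_closedBall.1 hb
    rw [dist_comm] at h2
    nlinarith
  set m₀ := Metric.infDist (Q b) Ω + Metric.infDist (P b) D with hm₀
  have n1 : 0 ≤ Metric.infDist (Q b) Ω := Metric.infDist_nonneg
  have n2 : 0 ≤ Metric.infDist (P b) D := Metric.infDist_nonneg
  have hm₀pos : 0 < m₀ := by
    refine lt_of_le_of_ne (by positivity) fun h0 => hbF ⟨?_, ?_⟩
    · exact (hD.mem_iff_infDist_zero ⟨_, hPzs⟩).2 (by linarith)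
    · exact (hΩ.mem_iff_infDist_zero ⟨_, hQzs⟩).2 (by linarith)
  -- Target bound for `dP`: being below `m₀` forces `dQ > 0`, and being below `ε * d / 2` makes the
  -- violation small relative to `dist z zs ≥ d / 2`.
  set τ := min m₀ (ε * d / 2)
  have hτ : 0 < τ := by positivity
  obtain ⟨j, hj⟩ : ∃ j : ℝ, ε ^ 2 * d < j * τ ^ 2 := ⟨(ε ^ 2 * d + 1) / τ ^ 2, by
    rw [div_mul_cancel₀ _ (by positivity)]; linarith⟩
  have hj0 : 0 < j := pos_of_mul_pos_left (lt_trans (by positivity) hj) (by positivity)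
  obtain ⟨z, hzB, hzmin⟩ := (isCompact_closedBall zs ρ).exists_isMinOn
    ⟨zs, Metric.mem_closedBall_self hρ.le⟩
    (f := fun z => Metric.infDist (Q z) Ω + ε * dist z a + j * Metric.infDist (P z) D ^ 2)
    (by fun_prop)
  have hmin : ∀ z' ∈ Metric.closedBall zs ρ, Metric.infDist (Q z) Ω + ε * dist z a +
      j * Metric.infDist (P z) D ^ 2 ≤ Metric.infDist (Q z') Ω + ε * dist z' a +
      j * Metric.infDist (P z') D ^ 2 := fun z' hz' => hzmin hz'
  have hva := hmin a (Metric.mem_closedBall.2 (by linarith))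
  rw [dist_self, mul_zero, add_zero, Metric.infDist_zero_of_mem ha] at hva
  -- The value at `a` is at most `ε ^ 2 * d`, which controls all three terms at the minimizer at
  -- once.
  set dQ := Metric.infDist (Q z) Ω with hdQ
  set dP := Metric.infDist (P z) D with hdP
  have nQ : 0 ≤ dQ := Metric.infDist_nonneg
  have nP : 0 ≤ dP := Metric.infDist_nonneg
  have nj : 0 ≤ j * dP ^ 2 := by positivity
  have nd : 0 ≤ ε * dist z a := by positivity
  have hdQle : dQ ≤ ε ^ 2 * d := by linarith
  have hza : dist z a ≤ ε * d := by
    have : ε * dist z a ≤ ε * (ε * d) := by nlinarith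
    exact le_of_mul_le_mul_left this hε
  have hdPτ : dP < τ := by
    have : dP ^ 2 < τ ^ 2 := lt_of_mul_lt_mul_left (by linarith) hj0.le
    exact lt_of_pow_lt_pow_left₀ 2 hτ.le this
  have hεd : ε * d ≤ d / 2 := by nlinarith
  have hz1 : d / 2 ≤ dist z zs := by
    have := dist_triangle_left a zs z
    linarith
  have hz2 : dist z zs ≤ 2 * dist a zs := by
    have := dist_triangle z a zs
    linarith
  have hdQpos : 0 < dQ := by
    have : m₀ ≤ dQ + dP := hbmin (Metric.mem_closedBall.2 hza)
    have : dP < m₀ := hdPτ.trans_le (min_le_left _ _)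
    linarith
  refine ⟨z, j, hj0, dist_pos.1 (by linarith), hz2, hdQpos, ?_, ?_, ?_, ?_⟩
  · nlinarith [mul_le_mul_of_nonneg_left hz1 hε.le]
  · have : dP < ε * d / 2 := hdPτ.trans_le (min_le_right _ _)
    nlinarith [mul_le_mul_of_nonneg_left hz1 hε.le]
  -- Test minimality against the projection `z'` of `z` onto `P⁻¹(D)`: the penalty vanishes there,
  -- while the other terms grow by at most `(L + ε) * dist z z' ≤ (L + 1) * c * dP`. Dividing by
  -- `dP` gives the bound.
  · obtain ⟨z', hz', hzd⟩ := (hD.preimage hP).exists_infDist_eq_dist ⟨zs, hPzs⟩ z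
    have k1 : dist z z' ≤ c * dP := hzd ▸ hreg z hzB
    have k2 : dist z z' ≤ dist z zs := hzd ▸ Metric.infDist_le_dist_of_mem hPzs
    have hz'B : z' ∈ Metric.closedBall zs ρ := by
      have := dist_triangle_left z' zs z
      exact Metric.mem_closedBall.2 (by linarith)
    have k3 := hmin z' hz'B
    rw [Metric.infDist_zero_of_mem (show P z' ∈ D from hz')] at k3
    have k4 := Metric.infDist_le_infDist_add_dist (s := Ω) (x := Q z') (y := Q z)
    have k5 := hlip z' hz'B z hzB
    have k6 := dist_triangle_left z' a z
    rw [dist_comm z' z] at k5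
    have k7 : j * dP ^ 2 ≤ (L + 1) * c * dP := by
      have : j * dP ^ 2 ≤ (L + ε) * dist z z' := by
        nlinarith [mul_le_mul_of_nonneg_left k6 hε.le]
      have : (L + ε) * dist z z' ≤ (L + 1) * (c * dP) :=
        mul_le_mul (by linarith) k1 dist_nonneg (by linarith)
      linarith
    change j * dP ≤ (L + 1) * c
    rcases nP.eq_or_lt with h0 | h0
    · rw [← h0, mul_zero]; positivity
    · exact le_of_mul_le_mul_right (by linarith) h0
  -- The minimizer is interior to the ball, so the triangle inequality turns the term in `dist z' a`
  -- into a slack `ε * dist z' z`.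
  · have hnhds : Metric.closedBall zs ρ ∈ 𝓝 z :=
      mem_of_superset (Metric.isOpen_ball.mem_nhds (Metric.mem_ball.2 (by linarith)))
        Metric.ball_subset_closedBall
    filter_upwards [hnhds] with z' hz'
    have k1 := hmin z' hz'
    have k5 := dist_triangle z' z a
    nlinarith [mul_le_mul_of_nonneg_left k5 hε.le]

end Penalization

/-! ### Stationarity and passage to directional normals -/

section Stationarity

variable {E Y U : Type*} [NormedAddCommGroup E] [InnerProductSpace ℝ E]
  [NormedAddCommGroup Y] [InnerProductSpace ℝ Y] [NormedAddCommGroup U] [InnerProductSpace ℝ U]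

/-- A nonnegative multiple of `q - y` is a regular normal at a nearest point `y` of `q`. -/
theorem smul_sub_mem_regularNormalCone {C : Set Y} {q y : Y} (hy : y ∈ C)
    (hmin : Metric.infDist q C = dist q y) {s : ℝ} (hs : 0 ≤ s) :
    s • (q - y) ∈ regularNormalCone C y := by
  refine ⟨hy, fun ε hε => ?_⟩
  have hball : ∀ᶠ y' in 𝓝[C] y, y' ∈ C ∧ s * ‖y' - y‖ < ε := by
    refine eventually_mem_nhdsWithin.and (Filter.Eventually.filter_mono nhdsWithin_le_nhds ?_)
    have : Tendsto (fun y' : Y => s * ‖y' - y‖) (𝓝 y) (𝓝 (s * ‖y - y‖)) :=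
      (Continuous.tendsto (by fun_prop) y)
    rw [sub_self, norm_zero, mul_zero] at this
    exact this.eventually_lt_const hε
  filter_upwards [hball] with y' ⟨hy', hsmall⟩
  have h1 : ‖q - y‖ ≤ ‖q - y'‖ := by
    rw [← dist_eq_norm, ← dist_eq_norm, ← hmin]
    exact Metric.infDist_le_dist_of_mem hy'
  have h2 : ‖q - y'‖ ^ 2 = ‖q - y‖ ^ 2 - 2 * inner ℝ (q - y) (y' - y) + ‖y' - y‖ ^ 2 := by
    rw [← norm_sub_sq_real]; congr 2; abel
  have h3 : inner ℝ (q - y) (y' - y) ≤ ‖y' - y‖ ^ 2 := by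
    nlinarith [norm_nonneg (q - y), sq_nonneg ‖y' - y‖]
  rw [real_inner_smul_left]
  nlinarith [norm_nonneg (y' - y), mul_le_mul_of_nonneg_left h3 hs]

/-- If `f` decreases at most at rate `ε` from `z`, its gradient at `z` has norm at most `ε`. -/
theorem norm_gradient_le_of_eventually_le {f : E → ℝ} {x z : E} {ε : ℝ} (hε : 0 ≤ ε)
    (hf : HasFDerivAt f (innerSL ℝ x) z) (hmin : ∀ᶠ z' in 𝓝 z, f z ≤ f z' + ε * ‖z' - z‖) :
    ‖x‖ ≤ ε := by
  refine le_of_forall_pos_le_add fun η hη => ?_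
  have h1 := hf.isLittleO.def hη
  have hline : Tendsto (fun t : ℝ => z - t • x) (𝓝[>] 0) (𝓝 z) := by
    have : Tendsto (fun t : ℝ => z - t • x) (𝓝 0) (𝓝 (z - (0 : ℝ) • x)) :=
      Continuous.tendsto (by fun_prop) 0
    rw [zero_smul, sub_zero] at this
    exact this.mono_left nhdsWithin_le_nhds
  -- A short step of steepest descent: first-order decrease is `t‖x‖²`, while the hypothesis allows
  -- only `ε t‖x‖` up to the error `η t‖x‖`.
  obtain ⟨t, ⟨ht1, ht2⟩, ht⟩ :=
    ((hline.eventually (h1.and hmin)).and self_mem_nhdsWithin).exists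
  have ht : 0 < t := ht
  have e : z - t • x - z = -(t • x) := by abel
  rw [e, map_neg, map_smul, innerSL_apply_apply, real_inner_self_eq_norm_sq, norm_neg, norm_smul,
    Real.norm_of_nonneg ht.le, Real.norm_eq_abs] at ht1
  rw [e, norm_neg, norm_smul, Real.norm_of_nonneg ht.le] at ht2
  have h3 := (abs_le.1 ht1).2
  simp only [smul_eq_mul] at h3
  rcases (norm_nonneg x).eq_or_lt with h0 | h0
  · rw [← h0]; positivity
  · have : t * ‖x‖ * ‖x‖ ≤ t * ‖x‖ * (ε + η) := by nlinarith
    exact le_of_mul_le_mul_left this (by positivity)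

theorem hasFDerivAt_norm_sub [CompleteSpace E] [CompleteSpace Y] {Q : E → Y} {z : E} {y : Y}
    (hQ : DifferentiableAt ℝ Q z) (hne : Q z ≠ y) :
    HasFDerivAt (fun z' => ‖Q z' - y‖)
      (innerSL ℝ ((fderiv ℝ Q z).adjoint (‖Q z - y‖⁻¹ • (Q z - y)))) z := by
  have hpos : ‖Q z - y‖ ≠ 0 := norm_ne_zero_iff.2 (sub_ne_zero.2 hne)
  have h1 := (hQ.hasFDerivAt.sub_const y).norm_sq
  have h2 := h1.sqrt (by positivity)
  simp only [Real.sqrt_sq (norm_nonneg _)] at h2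
  refine h2.congr_fderiv ?_
  ext v
  simp only [smul_apply, ContinuousLinearMap.comp_apply, innerSL_apply_apply,
    ContinuousLinearMap.adjoint_inner_left, real_inner_smul_left, smul_eq_mul, nsmul_eq_mul]
  field_simp
  simp

theorem hasFDerivAt_mul_norm_sub_sq [CompleteSpace E] [CompleteSpace Y] {Q : E → Y} {z : E} {y : Y}
    (hQ : DifferentiableAt ℝ Q z) (j : ℝ) :
    HasFDerivAt (fun z' => j * ‖Q z' - y‖ ^ 2)
      (innerSL ℝ ((fderiv ℝ Q z).adjoint ((2 * j) • (Q z - y)))) z := by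
  refine ((hQ.hasFDerivAt.sub_const y).norm_sq.const_mul j).congr_fderiv ?_
  ext v
  simp only [smul_apply, ContinuousLinearMap.comp_apply, innerSL_apply_apply,
    ContinuousLinearMap.adjoint_inner_left, real_inner_smul_left, smul_eq_mul, nsmul_eq_mul]
  push_cast
  ring

/-- Approximate stationarity at a minimizer of the penalized distance function. -/
theorem exists_regular_normals_of_penalized_minimizer [ProperSpace E] [ProperSpace Y] [ProperSpace U]
    {Q : E → Y} {P : E → U} {Ω : Set Y} {D : Set U} {z : E} {ε j : ℝ}
    (hQ : DifferentiableAt ℝ Q z) (hP : DifferentiableAt ℝ P z)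
    (hΩ : IsClosed Ω) (hD : IsClosed D) (hΩne : Ω.Nonempty) (hDne : D.Nonempty)
    (hε : 0 ≤ ε) (hj : 0 ≤ j) (hpos : 0 < Metric.infDist (Q z) Ω)
    (hmin : ∀ᶠ z' in 𝓝 z, Metric.infDist (Q z) Ω + j * Metric.infDist (P z) D ^ 2 ≤
        Metric.infDist (Q z') Ω + j * Metric.infDist (P z') D ^ 2 + ε * dist z' z) :
    ∃ (y l : Y) (u m : U), l ∈ regularNormalCone Ω y ∧ m ∈ regularNormalCone D u ∧
      ‖Q z - y‖ = Metric.infDist (Q z) Ω ∧ ‖P z - u‖ = Metric.infDist (P z) D ∧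
      ‖l‖ = 1 ∧ ‖m‖ = 2 * (j * Metric.infDist (P z) D) ∧
      ‖(fderiv ℝ Q z).adjoint l + (fderiv ℝ P z).adjoint m‖ ≤ ε := by
  obtain ⟨y, hy, hyd⟩ := hΩ.exists_infDist_eq_dist hΩne (Q z)
  obtain ⟨u, hu, hud⟩ := hD.exists_infDist_eq_dist hDne (P z)
  have hQy : ‖Q z - y‖ = Metric.infDist (Q z) Ω := by rw [← dist_eq_norm, ← hyd]
  have hPu : ‖P z - u‖ = Metric.infDist (P z) D := by rw [← dist_eq_norm, ← hud]
  have hne : Q z ≠ y := fun h => by rw [h, sub_self, norm_zero] at hQy; rw [h] at hpos; linarith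
  refine ⟨y, ‖Q z - y‖⁻¹ • (Q z - y), u, (2 * j) • (P z - u),
    smul_sub_mem_regularNormalCone hy hyd (by positivity),
    smul_sub_mem_regularNormalCone hu hud (by positivity), hQy, hPu, ?_, ?_, ?_⟩
  · rw [norm_smul, norm_inv, norm_norm, hQy, inv_mul_cancel₀ hpos.ne']
  · rw [norm_smul, hPu, Real.norm_of_nonneg (by positivity), mul_assoc]
  -- With `y` and `u` frozen, this function majorizes the penalized distances and agrees with them
  -- at `z`, so it inherits the approximate minimality; it is differentiable because `Q z ≠ y`.
  · refine norm_gradient_le_of_eventually_le hε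
      (f := fun z' => ‖Q z' - y‖ + j * ‖P z' - u‖ ^ 2) (z := z) ?_ ?_
    · rw [map_add]
      exact (hasFDerivAt_norm_sub hQ hne).add (hasFDerivAt_mul_norm_sub_sq hP j)
    · filter_upwards [hmin] with z' k1
      have k2 : Metric.infDist (Q z') Ω ≤ ‖Q z' - y‖ := by
        rw [← dist_eq_norm]; exact Metric.infDist_le_dist_of_mem hy
      have k3 : Metric.infDist (P z') D ≤ ‖P z' - u‖ := by
        rw [← dist_eq_norm]; exact Metric.infDist_le_dist_of_mem hu
      have k4 : j * Metric.infDist (P z') D ^ 2 ≤ j * ‖P z' - u‖ ^ 2 := by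
        gcongr
        exact Metric.infDist_nonneg
      rw [dist_eq_norm z' z] at k1
      simp only [hQy, hPu]
      linarith

/-- Regular normals at points approached in direction `Q'w` converge to directional normals. -/
theorem mem_directionalNormalCone_of_tendsto {Q : E → Y} {Ω : Set Y} {zs w : E} {Q' : E →L[ℝ] Y}
    (hQ : HasFDerivAt Q Q' zs) {z : ℕ → E} {y l : ℕ → Y} {ε : ℕ → ℝ} {l₀ : Y}
    (hz : Tendsto z atTop (𝓝 zs)) (hne : ∀ k, z k ≠ zs)
    (hw : Tendsto (fun k => ‖z k - zs‖⁻¹ • (z k - zs)) atTop (𝓝 w))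
    (hε : Tendsto ε atTop (𝓝 0)) (hy : ∀ k, ‖Q (z k) - y k‖ ≤ ε k * ‖z k - zs‖)
    (hl : Tendsto l atTop (𝓝 l₀)) (hly : ∀ k, l k ∈ regularNormalCone Ω (y k)) :
    l₀ ∈ directionalNormalCone Ω (Q zs) (Q' w) := by
  have hpos : ∀ k, 0 < ‖z k - zs‖ := fun k => norm_pos_iff.2 (sub_ne_zero.2 (hne k))
  have ht : Tendsto (fun k => ‖z k - zs‖) atTop (𝓝 0) := by
    simpa using (hz.sub_const zs).norm
  refine ⟨fun k => ‖z k - zs‖, fun k => ‖z k - zs‖⁻¹ • (y k - Q zs), l, hpos, ht, ?_, hl,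
    fun k => ?_⟩
  -- The difference quotient of `y k` splits into the projection error, the Taylor remainder of `Q`,
  -- and `Q'` of the normalized step; the first two vanish in the limit.
  · have h1 : Tendsto (fun k => ‖z k - zs‖⁻¹ • (y k - Q (z k))) atTop (𝓝 0) := by
      refine squeeze_zero_norm (fun k => ?_) hε
      rw [norm_smul, norm_inv, norm_norm, norm_sub_rev (y k), inv_mul_le_iff₀ (hpos k), mul_comm]
      exact hy k
    have h2 : Tendsto (fun k => ‖z k - zs‖⁻¹ • (Q (z k) - Q zs - Q' (z k - zs))) atTop (𝓝 0) := by
      rw [tendsto_zero_iff_norm_tendsto_zero]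
      have := (hasFDerivAt_iff_tendsto.1 hQ).comp hz
      refine this.congr fun k => ?_
      rw [norm_smul, norm_inv, norm_norm]
      rfl
    have h3 := ((Q'.continuous.tendsto w).comp hw).add (h1.add h2)
    rw [add_zero, add_zero] at h3
    refine h3.congr fun k => ?_
    simp only [Function.comp_apply, map_smul, ← smul_add]
    congr 1
    abel
  · rw [smul_smul, mul_inv_cancel₀ (hpos k).ne', one_smul, add_sub_cancel]
    exact hly k

theorem tendsto_adjoint_fderiv [CompleteSpace E] [CompleteSpace Y] {Q : E → Y}
    (hQ : ContDiff ℝ 1 Q) {z : ℕ → E} {l : ℕ → Y} {zs : E} {l₀ : Y}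
    (hz : Tendsto z atTop (𝓝 zs)) (hl : Tendsto l atTop (𝓝 l₀)) :
    Tendsto (fun k => (fderiv ℝ Q (z k)).adjoint (l k)) atTop
      (𝓝 ((fderiv ℝ Q zs).adjoint l₀)) := by
  have h : Tendsto (fun k => (fderiv ℝ Q (z k)).adjoint) atTop (𝓝 (fderiv ℝ Q zs).adjoint) :=
    (ContinuousLinearMap.adjoint.continuous.tendsto _).comp
      (((hQ.continuous_fderiv one_ne_zero).tendsto zs).comp hz)
  exact (isBoundedBilinearMap_apply.continuous.tendsto _).comp (h.prodMk_nhds hl)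

/-- If the error bound fails, there is a direction with a nontrivial multiplier. -/
theorem exists_directional_multipliers [ProperSpace E] [ProperSpace Y] [ProperSpace U]
    {Q : E → Y} {P : E → U} {Ω : Set Y} {D : Set U}
    (hQ : ContDiff ℝ 1 Q) (hP : ContDiff ℝ 1 P) (hΩ : IsClosed Ω) (hD : IsClosed D) {zs : E}
    (hQzs : Q zs ∈ Ω) (hreg : MetricallySubregularAt P D zs)
    (hfail : ∀ κ : ℝ, 0 < κ → ∀ δ : ℝ, 0 < δ → ∃ z ∈ Metric.ball zs δ,
      κ * (Metric.infDist (P z) D + Metric.infDist (Q z) Ω) <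
        Metric.infDist z {x | P x ∈ D ∧ Q x ∈ Ω}) :
    ∃ (w : E) (l : Y) (m : U), w ≠ 0 ∧ l ≠ 0 ∧
      l ∈ directionalNormalCone Ω (Q zs) (fderiv ℝ Q zs w) ∧
      m ∈ directionalNormalCone D (P zs) (fderiv ℝ P zs w) ∧
      (fderiv ℝ Q zs).adjoint l + (fderiv ℝ P zs).adjoint m = 0 := by
  obtain ⟨hPzs, c, hc, hreg⟩ := hreg
  obtain ⟨L, s, hs, hLip⟩ := hQ.contDiffAt.exists_lipschitzOnWith (x := zs)
  obtain ⟨ρ, hρ, hball⟩ := Metric.nhds_basis_closedBall.mem_iff.1 (inter_mem hreg hs)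
  have hreg' : ∀ z ∈ Metric.closedBall zs ρ,
      Metric.infDist z {x | P x ∈ D} ≤ c * Metric.infDist (P z) D := fun z hz => (hball hz).1
  have hlip : ∀ z ∈ Metric.closedBall zs ρ, ∀ z' ∈ Metric.closedBall zs ρ,
      dist (Q z) (Q z') ≤ L * dist z z' :=
    fun z hz z' hz' => hLip.dist_le_mul z (hball hz).2 z' (hball hz').2
  have key : ∀ k : ℕ, ∃ (z : E) (y l : Y) (u m : U), z ≠ zs ∧ dist z zs ≤ 1 / ((k : ℝ) + 1) ∧
      l ∈ regularNormalCone Ω y ∧ m ∈ regularNormalCone D u ∧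
      ‖Q z - y‖ ≤ 1 / ((k : ℝ) + 1) * ‖z - zs‖ ∧ ‖P z - u‖ ≤ 1 / ((k : ℝ) + 1) * ‖z - zs‖ ∧
      ‖l‖ = 1 ∧ ‖m‖ ≤ 2 * ((L + 1) * c) ∧
      ‖(fderiv ℝ Q z).adjoint l + (fderiv ℝ P z).adjoint m‖ ≤ 1 / ((k : ℝ) + 1) := by
    intro k
    set ε : ℝ := 1 / ((k : ℝ) + 1)
    have hε : 0 < ε := by positivity
    -- The penalization lemma needs a parameter at most `1 / 2` and a residual ratio equal to its
    -- square.
    set η := min ε (1 / 2)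
    have hη : 0 < η := by positivity
    have hηε : η ≤ ε := min_le_left _ _
    obtain ⟨a, ha, had, hapos, haΩ⟩ := exists_infDist_le_mul_infDist hP.continuous hD hPzs hQzs hc
      L.2 hρ hreg' hlip hfail (pow_pos hη 2) (show 0 < min (ε / 2) (ρ / 4) by positivity)
    have had1 := had.trans_le (min_le_left _ _)
    obtain ⟨z, j, hj, hz, hza, hQpos, hQle, hPle, hjle, hmin⟩ := exists_penalized_minimizer
      hQ.continuous hP.continuous hΩ hD hPzs hQzs hc L.2 hρ hreg' hlip hη (min_le_right _ _) ha
      (had.trans_le (min_le_right _ _)) hapos haΩ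
    obtain ⟨y, l, u, m, hl, hm, hy, hu, hl1, hm1, hsum⟩ :=
      exists_regular_normals_of_penalized_minimizer (hQ.differentiable one_ne_zero z)
        (hP.differentiable one_ne_zero z) hΩ hD ⟨_, hQzs⟩ ⟨_, hPzs⟩ hη.le hj.le hQpos hmin
    have hle : η * dist z zs ≤ ε * dist z zs := mul_le_mul_of_nonneg_right hηε dist_nonneg
    refine ⟨z, y, l, u, m, hz, by linarith, hl, hm, ?_, ?_, hl1, ?_, hsum.trans hηε⟩
    · rw [hy, ← dist_eq_norm]; exact hQle.trans hle
    · rw [hu, ← dist_eq_norm]; exact hPle.trans hle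
    · rw [hm1]; exact mul_le_mul_of_nonneg_left hjle two_pos.le
  choose z y l u m hz hzk hl hm hy hu hl1 hm1 hsum using key
  have hε : Tendsto (fun k : ℕ => 1 / ((k : ℝ) + 1)) atTop (𝓝 0) :=
    tendsto_one_div_add_atTop_nhds_zero_nat
  have hzlim : Tendsto z atTop (𝓝 zs) :=
    tendsto_iff_dist_tendsto_zero.2 (squeeze_zero (fun _ => dist_nonneg) hzk hε)
  have hw1 : ∀ k, ‖z k - zs‖⁻¹ • (z k - zs) ∈ Metric.sphere (0 : E) 1 := fun k => by
    rw [mem_sphere_zero_iff_norm, norm_smul, norm_inv, norm_norm,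
      inv_mul_cancel₀ (norm_ne_zero_iff.2 (sub_ne_zero.2 (hz k)))]
  -- Directions and `Ω`-normals live on unit spheres, so their limits cannot vanish; the `D`-normals
  -- are only bounded.
  obtain ⟨⟨w, l₀, m₀⟩, ⟨hw, hl₀, -⟩, φ, hφ, hlim⟩ :=
    (((isCompact_sphere (0 : E) 1).prod ((isCompact_sphere (0 : Y) 1).prod
      (isCompact_closedBall (0 : U) (2 * ((L + 1) * c))))).tendsto_subseq
      (x := fun k => (‖z k - zs‖⁻¹ • (z k - zs), l k, m k))) fun k =>
        ⟨hw1 k, mem_sphere_zero_iff_norm.2 (hl1 k), mem_closedBall_zero_iff.2 (hm1 k)⟩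
  have lw := (Prod.tendsto_iff _ _).1 hlim
  have llm := (Prod.tendsto_iff _ _).1 lw.2
  have hφt := hφ.tendsto_atTop
  refine ⟨w, l₀, m₀, ne_zero_of_mem_unit_sphere ⟨w, hw⟩, ne_zero_of_mem_unit_sphere ⟨l₀, hl₀⟩,
    mem_directionalNormalCone_of_tendsto (hQ.differentiable one_ne_zero zs).hasFDerivAt
      (hzlim.comp hφt) (fun k => hz (φ k)) lw.1 (hε.comp hφt) (fun k => hy (φ k)) llm.1
      (fun k => hl (φ k)),
    mem_directionalNormalCone_of_tendsto (hP.differentiable one_ne_zero zs).hasFDerivAt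
      (hzlim.comp hφt) (fun k => hz (φ k)) lw.1 (hε.comp hφt) (fun k => hu (φ k)) llm.2
      (fun k => hm (φ k)), ?_⟩
  have hsumlim := (tendsto_adjoint_fderiv hQ (hzlim.comp hφt) llm.1).add
    (tendsto_adjoint_fderiv hP (hzlim.comp hφt) llm.2)
  exact tendsto_nhds_unique hsumlim (squeeze_zero_norm (fun k => hsum (φ k)) (hε.comp hφt))

end Stationarity

/-! ### Calculus of tangent and normal cones -/

section NormalCones

variable {E V : Type*} [NormedAddCommGroup E] [InnerProductSpace ℝ E]
  [NormedAddCommGroup V] [InnerProductSpace ℝ V]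

/-- This extracts a component of a normal to a product set. Here `ι` acts as the adjoint of `π`, and
`hC'` says that one component may be varied inside `C'` with the others fixed; testing `v` on these
variations tests `π v` on `C'`. -/
theorem map_mem_regularNormalCone {C : Set E} {C' : Set V} (π : E →L[ℝ] V) (ι : V → E)
    (hnorm : ∀ a, ‖ι a‖ ≤ ‖a‖) (hinner : ∀ v a, inner ℝ v (ι a) = inner ℝ (π v) a)
    (hC : ∀ u ∈ C, π u ∈ C') (hC' : ∀ u ∈ C, ∀ a ∈ C', u + ι (a - π u) ∈ C)
    {u v : E} (hv : v ∈ regularNormalCone C u) : π v ∈ regularNormalCone C' (π u) := by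
  refine ⟨hC u hv.1, fun ε hε => ?_⟩
  have hlim : Tendsto (fun a => u + ι (a - π u)) (𝓝[C'] (π u)) (𝓝[C] u) := by
    refine tendsto_nhdsWithin_iff.2 ⟨?_, ?_⟩
    · have h0 : Tendsto (fun a => ι (a - π u)) (𝓝 (π u)) (𝓝 0) :=
        squeeze_zero_norm (fun a => hnorm _)
          (by simpa using (Continuous.tendsto (by fun_prop) (π u) :
            Tendsto (fun a : V => ‖a - π u‖) (𝓝 (π u)) (𝓝 ‖π u - π u‖)))
      simpa using (h0.const_add u).mono_left (nhdsWithin_le_nhds (s := C'))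
    · filter_upwards [self_mem_nhdsWithin] with a ha using hC' u hv.1 a ha
  filter_upwards [hlim.eventually (hv.2 ε hε)] with a ha
  rw [add_sub_cancel_left, hinner] at ha
  exact ha.trans (mul_le_mul_of_nonneg_left (hnorm _) hε.le)

theorem map_mem_directionalNormalCone {C : Set E} {C' : Set V} (π : E →L[ℝ] V) (ι : V → E)
    (hnorm : ∀ a, ‖ι a‖ ≤ ‖a‖) (hinner : ∀ v a, inner ℝ v (ι a) = inner ℝ (π v) a)
    (hC : ∀ u ∈ C, π u ∈ C') (hC' : ∀ u ∈ C, ∀ a ∈ C', u + ι (a - π u) ∈ C)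
    {z d v : E} (hv : v ∈ directionalNormalCone C z d) :
    π v ∈ directionalNormalCone C' (π z) (π d) := by
  obtain ⟨t, e, y, ht, ht0, he, hy, hmem⟩ := hv
  refine ⟨t, fun k => π (e k), fun k => π (y k), ht, ht0, (π.continuous.tendsto d).comp he,
    (π.continuous.tendsto v).comp hy, fun k => ?_⟩
  rw [← map_smul, ← map_add]
  exact map_mem_regularNormalCone π ι hnorm hinner hC hC' (hmem k)

/-- Regular normals exist only at points of `C`, so the base points of the normals witness tangency.
-/
theorem mem_tangentConeB_of_mem_directionalNormalCone {C : Set E} {z d v : E}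
    (hv : v ∈ directionalNormalCone C z d) : d ∈ tangentConeB C z := by
  obtain ⟨t, e, y, ht, ht0, he, -, hmem⟩ := hv
  exact ⟨t, e, ht, ht0, he, fun k => (hmem k).1⟩

/-- Directional normals are limiting normals. -/
theorem directionalNormalCone_subset_limitingNormalCone {C : Set E} {z d : E} :
    directionalNormalCone C z d ⊆ limitingNormalCone C z := by
  rintro v ⟨t, e, y, -, ht0, he, hy, hmem⟩
  refine ⟨fun k => z + t k • e k, y, ?_, hy, hmem⟩
  simpa using (ht0.smul he).const_add z

/-- Test the normal inequality along the ray `x + s • p` and divide by `s`. -/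
theorem inner_nonpos_of_mem_regularNormalCone {C : Set E} {x v p : E}
    (hv : v ∈ regularNormalCone C x) (hp : ∀ᶠ s : ℝ in 𝓝[>] 0, x + s • p ∈ C) :
    inner ℝ v p ≤ 0 := by
  refine le_of_forall_pos_le_add fun ε hε => ?_
  have hlim : Tendsto (fun s : ℝ => x + s • p) (𝓝[>] 0) (𝓝[C] x) := by
    refine tendsto_nhdsWithin_iff.2 ⟨?_, hp⟩
    have : Tendsto (fun s : ℝ => x + s • p) (𝓝 0) (𝓝 (x + (0 : ℝ) • p)) :=
      Continuous.tendsto (by fun_prop) 0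
    rw [zero_smul, add_zero] at this
    exact this.mono_left nhdsWithin_le_nhds
  have hη : 0 < ε / (‖p‖ + 1) := by positivity
  obtain ⟨s, hs, hs0⟩ := ((hlim.eventually (hv.2 _ hη)).and self_mem_nhdsWithin).exists
  have hs0 : 0 < s := hs0
  rw [add_sub_cancel_left, real_inner_smul_right, norm_smul, Real.norm_of_nonneg hs0.le] at hs
  have h1 : inner ℝ v p ≤ ε / (‖p‖ + 1) * ‖p‖ :=
    le_of_mul_le_mul_left (hs.trans_eq (by ring)) hs0
  have h2 : ε / (‖p‖ + 1) * ‖p‖ ≤ ε := by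
    rw [div_mul_eq_mul_div, div_le_iff₀ (by positivity)]
    nlinarith [norm_nonneg p]
  linarith

theorem mem_regularNormalCone_of_smul {C : Set E} (hC : ∀ t : ℝ, 0 < t → ∀ x ∈ C, t • x ∈ C)
    {t : ℝ} (ht : 0 < t) {x v : E} (hv : v ∈ regularNormalCone C (t • x)) :
    v ∈ regularNormalCone C x := by
  refine ⟨?_, fun ε hε => ?_⟩
  · have := hC t⁻¹ (inv_pos.2 ht) _ hv.1
    rwa [smul_smul, inv_mul_cancel₀ ht.ne', one_smul] at this
  · have hlim : Tendsto (fun a => t • a) (𝓝[C] x) (𝓝[C] (t • x)) :=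
      tendsto_nhdsWithin_iff.2 ⟨(Continuous.tendsto (by fun_prop) x).mono_left nhdsWithin_le_nhds,
        by filter_upwards [self_mem_nhdsWithin] with a ha using hC t ht a ha⟩
    filter_upwards [hlim.eventually (hv.2 ε hε)] with a ha
    rw [← smul_sub, real_inner_smul_right, norm_smul, Real.norm_of_nonneg ht.le] at ha
    exact le_of_mul_le_mul_left (ha.trans_eq (by ring)) ht

/-- Regular normals to a cone are invariant under dilation of the base point, so the factors `t k`
drop out. This produces the condition on the biactive indices. -/
theorem mem_limitingNormalCone_of_cone {C : Set E} (hC : ∀ t : ℝ, 0 < t → ∀ x ∈ C, t • x ∈ C)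
    {d v : E} (hv : v ∈ directionalNormalCone C 0 d) : v ∈ limitingNormalCone C d := by
  obtain ⟨t, e, y, ht, -, he, hy, hmem⟩ := hv
  refine ⟨e, y, he, hy, fun k => mem_regularNormalCone_of_smul hC (ht k) ?_⟩
  simpa using hmem k

theorem map_mem_tangentConeB {C : Set E} {C' : Set V} (π : E →L[ℝ] V) (hC : ∀ u ∈ C, π u ∈ C')
    {z d : E} (hd : d ∈ tangentConeB C z) : π d ∈ tangentConeB C' (π z) := by
  obtain ⟨t, e, ht, ht0, he, hmem⟩ := hd
  refine ⟨t, fun k => π (e k), ht, ht0, (π.continuous.tendsto d).comp he, fun k => ?_⟩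
  rw [← map_smul, ← map_add]
  exact hC _ (hmem k)

end NormalCones

/-! ### Normals and tangents of the complementarity cone -/

section ComplementarityCone

theorem isClosed_complementarityCone : IsClosed complementarityCone := by
  have h1 : Continuous fun u : WithLp 2 (ℝ × ℝ) => u.fst := by fun_prop
  have h2 : Continuous fun u : WithLp 2 (ℝ × ℝ) => u.snd := by fun_prop
  exact (isClosed_le continuous_const h1).inter
    ((isClosed_le continuous_const h2).inter (isClosed_eq (h1.mul h2) continuous_const))

theorem smul_mem_complementarityCone (t : ℝ) (ht : 0 < t) (x : WithLp 2 (ℝ × ℝ))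
    (hx : x ∈ complementarityCone) : t • x ∈ complementarityCone := by
  obtain ⟨h1, h2, h3⟩ := hx
  refine ⟨mul_nonneg ht.le h1, mul_nonneg ht.le h2, ?_⟩
  change t * x.fst * (t * x.snd) = 0
  rw [mul_mul_mul_comm, h3, mul_zero]

/-- Near `a` the cone is a piece of the first axis, so both directions along that axis are feasible
and regular normals are orthogonal to it. -/
theorem fst_eq_zero_of_mem_limitingNormalCone {a v : WithLp 2 (ℝ × ℝ)} (ha : 0 < a.fst)
    (hv : v ∈ limitingNormalCone complementarityCone a) : v.fst = 0 := by
  obtain ⟨x, y, hx, hy, hmem⟩ := hv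
  have hpos : ∀ᶠ k in atTop, 0 < (x k).fst :=
    (((WithLp.fstL 2 ℝ ℝ ℝ).continuous.tendsto a).comp hx).eventually_const_lt ha
  have hzero : ∀ᶠ k in atTop, (y k).fst = 0 := by
    filter_upwards [hpos] with k hk
    have hsnd : (x k).snd = 0 := (mul_eq_zero.1 (hmem k).1.2.2).resolve_left hk.ne'
    have hdir : ∀ c : ℝ, ∀ᶠ s : ℝ in 𝓝[>] 0,
        x k + s • (l2pair c 0 : WithLp 2 (ℝ × ℝ)) ∈ complementarityCone := fun c => by
      have hl : Tendsto (fun s : ℝ => (x k).fst + s * c) (𝓝[>] 0) (𝓝 ((x k).fst + 0 * c)) :=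
        (Continuous.tendsto (by fun_prop) 0).mono_left nhdsWithin_le_nhds
      filter_upwards [hl.eventually_const_lt (by simpa using hk)] with s hs
      refine ⟨hs.le, ?_, ?_⟩ <;> simp [hsnd]
    have h1 := inner_nonpos_of_mem_regularNormalCone (hmem k) (hdir 1)
    have h2 := inner_nonpos_of_mem_regularNormalCone (hmem k) (hdir (-1))
    simp [WithLp.prod_inner_apply] at h1 h2
    exact le_antisymm h1 h2
  exact tendsto_nhds_unique (((WithLp.fstL 2 ℝ ℝ ℝ).continuous.tendsto v).comp hy)
    (tendsto_const_nhds.congr' (hzero.mono fun k hk => hk.symm))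

theorem snd_eq_zero_of_mem_limitingNormalCone {a v : WithLp 2 (ℝ × ℝ)} (ha : 0 < a.snd)
    (hv : v ∈ limitingNormalCone complementarityCone a) : v.snd = 0 := by
  obtain ⟨x, y, hx, hy, hmem⟩ := hv
  have hpos : ∀ᶠ k in atTop, 0 < (x k).snd :=
    (((WithLp.sndL 2 ℝ ℝ ℝ).continuous.tendsto a).comp hx).eventually_const_lt ha
  have hzero : ∀ᶠ k in atTop, (y k).snd = 0 := by
    filter_upwards [hpos] with k hk
    have hfst : (x k).fst = 0 := (mul_eq_zero.1 (hmem k).1.2.2).resolve_right hk.ne'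
    have hdir : ∀ c : ℝ, ∀ᶠ s : ℝ in 𝓝[>] 0,
        x k + s • (l2pair 0 c : WithLp 2 (ℝ × ℝ)) ∈ complementarityCone := fun c => by
      have hl : Tendsto (fun s : ℝ => (x k).snd + s * c) (𝓝[>] 0) (𝓝 ((x k).snd + 0 * c)) :=
        (Continuous.tendsto (by fun_prop) 0).mono_left nhdsWithin_le_nhds
      filter_upwards [hl.eventually_const_lt (by simpa using hk)] with s hs
      refine ⟨?_, hs.le, ?_⟩ <;> simp [hfst]
    have h1 := inner_nonpos_of_mem_regularNormalCone (hmem k) (hdir 1)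
    have h2 := inner_nonpos_of_mem_regularNormalCone (hmem k) (hdir (-1))
    simp [WithLp.prod_inner_apply] at h1 h2
    exact le_antisymm h1 h2
  exact tendsto_nhds_unique (((WithLp.sndL 2 ℝ ℝ ℝ).continuous.tendsto v).comp hy)
    (tendsto_const_nhds.congr' (hzero.mono fun k hk => hk.symm))

/-- Points of the cone near `a` have zero second component, hence so do the approximating
directions. -/
theorem snd_eq_zero_of_mem_tangentConeB {a d : WithLp 2 (ℝ × ℝ)} (ha : 0 < a.fst)
    (ha2 : a.snd = 0) (hd : d ∈ tangentConeB complementarityCone a) : d.snd = 0 := by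
  obtain ⟨t, e, ht, ht0, he, hmem⟩ := hd
  have hx : Tendsto (fun k => a + t k • e k) atTop (𝓝 a) := by
    simpa using (ht0.smul he).const_add a
  have hzero : ∀ᶠ k in atTop, (e k).snd = 0 := by
    filter_upwards [(((WithLp.fstL 2 ℝ ℝ ℝ).continuous.tendsto a).comp hx).eventually_const_lt
      ha] with k hk
    have h0 : a.snd + t k * (e k).snd = 0 := (mul_eq_zero.1 (hmem k).2.2).resolve_left hk.ne'
    rw [ha2, zero_add] at h0
    exact (mul_eq_zero.1 h0).resolve_left (ht k).ne'
  exact tendsto_nhds_unique (((WithLp.sndL 2 ℝ ℝ ℝ).continuous.tendsto d).comp he)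
    (tendsto_const_nhds.congr' (hzero.mono fun k hk => hk.symm))

theorem fst_eq_zero_of_mem_tangentConeB {a d : WithLp 2 (ℝ × ℝ)} (ha : 0 < a.snd)
    (ha2 : a.fst = 0) (hd : d ∈ tangentConeB complementarityCone a) : d.fst = 0 := by
  obtain ⟨t, e, ht, ht0, he, hmem⟩ := hd
  have hx : Tendsto (fun k => a + t k • e k) atTop (𝓝 a) := by
    simpa using (ht0.smul he).const_add a
  have hzero : ∀ᶠ k in atTop, (e k).fst = 0 := by
    filter_upwards [(((WithLp.sndL 2 ℝ ℝ ℝ).continuous.tendsto a).comp hx).eventually_const_lt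
      ha] with k hk
    have h0 : a.fst + t k * (e k).fst = 0 := (mul_eq_zero.1 (hmem k).2.2).resolve_right hk.ne'
    rw [ha2, zero_add] at h0
    exact (mul_eq_zero.1 h0).resolve_left (ht k).ne'
  exact tendsto_nhds_unique (((WithLp.fstL 2 ℝ ℝ ℝ).continuous.tendsto d).comp he)
    (tendsto_const_nhds.congr' (hzero.mono fun k hk => hk.symm))

theorem tangentConeB_zero_subset_of_isClosed_cone {E : Type*} [NormedAddCommGroup E]
    [InnerProductSpace ℝ E] {C : Set E} (hcl : IsClosed C)
    (hC : ∀ t : ℝ, 0 < t → ∀ x ∈ C, t • x ∈ C) : tangentConeB C 0 ⊆ C := by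
  rintro d ⟨t, e, ht, -, he, hmem⟩
  refine hcl.mem_of_tendsto he (Eventually.of_forall fun k => ?_)
  have := hC (t k)⁻¹ (inv_pos.2 (ht k)) _ (hmem k)
  rwa [zero_add, smul_smul, inv_mul_cancel₀ (ht k).ne', one_smul] at this

end ComplementarityCone

/-! ### Normals to the half-line -/

section Nonpositive

theorem nonneg_of_mem_limitingNormalCone_Iic {a v : ℝ}
    (hv : v ∈ limitingNormalCone (Set.Iic (0 : ℝ)) a) : 0 ≤ v := by
  obtain ⟨x, y, -, hy, hmem⟩ := hv
  refine ge_of_tendsto' hy fun k => ?_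
  have h1 := inner_nonpos_of_mem_regularNormalCone (p := (-1 : ℝ)) (hmem k) (by
    filter_upwards [self_mem_nhdsWithin] with s (hs : 0 < s)
    have : x k ≤ 0 := (hmem k).1
    simp only [Set.mem_Iic, smul_eq_mul]
    linarith)
  simpa using h1

theorem eq_zero_of_mem_limitingNormalCone_Iic {a v : ℝ} (ha : a < 0)
    (hv : v ∈ limitingNormalCone (Set.Iic (0 : ℝ)) a) : v = 0 := by
  refine le_antisymm ?_ (nonneg_of_mem_limitingNormalCone_Iic hv)
  obtain ⟨x, y, hx, hy, hmem⟩ := hv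
  refine le_of_tendsto hy ?_
  filter_upwards [hx.eventually_lt_const ha] with k hk
  have hl : Tendsto (fun s : ℝ => x k + s • (1 : ℝ)) (𝓝[>] 0) (𝓝 (x k + (0 : ℝ) • (1 : ℝ))) :=
    (Continuous.tendsto (by fun_prop) 0).mono_left nhdsWithin_le_nhds
  have h1 := inner_nonpos_of_mem_regularNormalCone (p := (1 : ℝ)) (hmem k) (by
    filter_upwards [hl.eventually_lt_const (by simpa using hk)] with s hs using hs.le)
  simpa using h1

end Nonpositive

/-! ### Products of sets of pairs -/

section BlockPairs

variable {ι : Type*} {V : ι → Type*} [∀ i, NormedAddCommGroup (V i)]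
  [∀ i, InnerProductSpace ℝ (V i)]

/-- The `i`-th pair of blocks of a pair of block vectors. -/
noncomputable def blockPair (i : ι) :
    WithLp 2 (PiLp 2 V × PiLp 2 V) →L[ℝ] WithLp 2 (V i × V i) :=
  (WithLp.prodContinuousLinearEquiv 2 ℝ (V i) (V i)).symm.toContinuousLinearMap ∘L
    ((PiLp.proj 2 V i ∘L WithLp.fstL 2 ℝ (PiLp 2 V) (PiLp 2 V)).prod
      (PiLp.proj 2 V i ∘L WithLp.sndL 2 ℝ (PiLp 2 V) (PiLp 2 V)))

theorem blockPair_apply (i : ι) (u : WithLp 2 (PiLp 2 V × PiLp 2 V)) :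
    blockPair i u = l2pair (u.fst i) (u.snd i) := rfl

/-- The product of sets of pairs, as a set of pairs of block vectors. -/
def blockPairSet (C : ∀ i, Set (WithLp 2 (V i × V i))) : Set (WithLp 2 (PiLp 2 V × PiLp 2 V)) :=
  {u | ∀ i, blockPair i u ∈ C i}

theorem isClosed_blockPairSet {C : ∀ i, Set (WithLp 2 (V i × V i))} (hC : ∀ i, IsClosed (C i)) :
    IsClosed (blockPairSet C) := by
  rw [blockPairSet, Set.ofPred_forall]
  exact isClosed_iInter fun i => (hC i).preimage (blockPair (V := V) i).continuous

variable [Fintype ι]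

theorem blockPair_mem_tangentConeB {C : ∀ i, Set (WithLp 2 (V i × V i))}
    {z d : WithLp 2 (PiLp 2 V × PiLp 2 V)} (hd : d ∈ tangentConeB (blockPairSet C) z) (i : ι) :
    blockPair i d ∈ tangentConeB (C i) (blockPair i z) :=
  map_mem_tangentConeB (C := blockPairSet C) (blockPair i) (fun _ hu => hu i) hd

theorem blockPair_mem_directionalNormalCone {C : ∀ i, Set (WithLp 2 (V i × V i))}
    {z d v : WithLp 2 (PiLp 2 V × PiLp 2 V)}
    (hv : v ∈ directionalNormalCone (blockPairSet C) z d) (i : ι) :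
    blockPair i v ∈ directionalNormalCone (C i) (blockPair i z) (blockPair i d) := by
  classical
  refine map_mem_directionalNormalCone (C := blockPairSet C) (blockPair i)
    (fun a => l2pair (PiLp.single 2 i a.fst) (PiLp.single 2 i a.snd)) (fun a => le_of_eq ?_)
    (fun v a => ?_) (fun u hu => hu i) (fun u hu a ha k => ?_) hv
  · simp [WithLp.prod_norm_eq_of_L2]
  · simp only [WithLp.prod_inner_apply, PiLp.inner_apply, blockPair_apply]
    congr 1
    · rw [Finset.sum_eq_single i (fun k _ hk => by simp [hk]) (by simp)]
      simp
    · rw [Finset.sum_eq_single i (fun k _ hk => by simp [hk]) (by simp)]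
      simp
  · by_cases hk : k = i
    · subst hk
      convert ha using 1
      refine WithLp.ofLp_injective 2 (Prod.ext ?_ ?_) <;> simp [blockPair_apply]
    · convert hu k using 1
      refine WithLp.ofLp_injective 2 (Prod.ext ?_ ?_) <;> simp [blockPair_apply, hk]

theorem norm_le_sum_norm_blockPair (u : WithLp 2 (PiLp 2 V × PiLp 2 V)) :
    ‖u‖ ≤ ∑ i, ‖blockPair i u‖ := by
  refine le_of_sq_le_sq ?_ (Finset.sum_nonneg fun i _ => norm_nonneg _)
  refine le_trans (le_of_eq ?_) (Finset.sum_sq_le_sq_sum_of_nonneg fun i _ => norm_nonneg _)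
  rw [WithLp.prod_norm_sq_eq_of_L2, PiLp.norm_sq_eq_of_L2, PiLp.norm_sq_eq_of_L2,
    ← Finset.sum_add_distrib]
  simp [WithLp.prod_norm_sq_eq_of_L2, blockPair_apply]

/-- Project each block separately and reassemble the nearest points; the norm is at most the sum of
the block norms. -/
theorem infDist_blockPairSet_le [∀ i, FiniteDimensional ℝ (V i)]
    {C : ∀ i, Set (WithLp 2 (V i × V i))} (hC : ∀ i, IsClosed (C i)) (hne : ∀ i, (C i).Nonempty)
    (u : WithLp 2 (PiLp 2 V × PiLp 2 V)) :
    ∃ v ∈ blockPairSet C, ‖u - v‖ ≤ ∑ i, Metric.infDist (blockPair i u) (C i) := by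
  have : ∀ i, ∃ a ∈ C i, Metric.infDist (blockPair i u) (C i) = dist (blockPair i u) a :=
    fun i => (hC i).exists_infDist_eq_dist (hne i) _
  choose a ha hd using this
  let v : WithLp 2 (PiLp 2 V × PiLp 2 V) :=
    l2pair (WithLp.toLp 2 fun i => (a i).fst) (WithLp.toLp 2 fun i => (a i).snd)
  have hv : ∀ i, blockPair i v = a i := fun i => rfl
  refine ⟨v, fun i => (hv i).symm ▸ ha i, (norm_le_sum_norm_blockPair _).trans_eq ?_⟩
  exact Finset.sum_congr rfl fun i _ => by rw [hd, dist_eq_norm, map_sub, hv]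

end BlockPairs

/-! ### Pairs with the Euclidean norm -/

section Pairs

theorem norm_l2pair_le {A B : Type*} [NormedAddCommGroup A] [NormedAddCommGroup B]
    (a : A) (b : B) : ‖l2pair a b‖ ≤ ‖a‖ + ‖b‖ := by
  refine le_of_sq_le_sq ?_ (by positivity)
  rw [WithLp.prod_norm_sq_eq_of_L2]
  change ‖a‖ ^ 2 + ‖b‖ ^ 2 ≤ _
  nlinarith [norm_nonneg a, norm_nonneg b]

variable {E A B : Type*} [NormedAddCommGroup E] [InnerProductSpace ℝ E]
  [NormedAddCommGroup A] [InnerProductSpace ℝ A] [NormedAddCommGroup B] [InnerProductSpace ℝ B]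

theorem contDiff_l2pair {f : E → A} {g : E → B} (hf : ContDiff ℝ 1 f) (hg : ContDiff ℝ 1 g) :
    ContDiff ℝ 1 (fun z => l2pair (f z) (g z)) :=
  (WithLp.prodContinuousLinearEquiv 2 ℝ A B).symm.contDiff.comp (hf.prodMk hg)

theorem hasFDerivAt_l2pair {f : E → A} {g : E → B} {z : E} {f' : E →L[ℝ] A} {g' : E →L[ℝ] B}
    (hf : HasFDerivAt f f' z) (hg : HasFDerivAt g g' z) :
    HasFDerivAt (fun z => l2pair (f z) (g z))
      ((WithLp.prodContinuousLinearEquiv 2 ℝ A B).symm.toContinuousLinearMap ∘L f'.prod g') z :=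
  (WithLp.prodContinuousLinearEquiv 2 ℝ A B).symm.hasFDerivAt.comp z (hf.prodMk hg)

theorem fderiv_l2pair_apply {f : E → A} {g : E → B} {z : E} (hf : DifferentiableAt ℝ f z)
    (hg : DifferentiableAt ℝ g z) (w : E) :
    fderiv ℝ (fun z => l2pair (f z) (g z)) z w = l2pair (fderiv ℝ f z w) (fderiv ℝ g z w) := by
  rw [(hasFDerivAt_l2pair hf.hasFDerivAt hg.hasFDerivAt).fderiv]
  rfl

theorem adjoint_fderiv_l2pair [CompleteSpace E] [CompleteSpace A] [CompleteSpace B]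
    {f : E → A} {g : E → B} {z : E} (hf : DifferentiableAt ℝ f z)
    (hg : DifferentiableAt ℝ g z) (l : WithLp 2 (A × B)) :
    (fderiv ℝ (fun z => l2pair (f z) (g z)) z).adjoint l =
      (fderiv ℝ f z).adjoint l.fst + (fderiv ℝ g z).adjoint l.snd := by
  refine ext_inner_right ℝ fun w => ?_
  rw [ContinuousLinearMap.adjoint_inner_left, fderiv_l2pair_apply hf hg, inner_add_left,
    ContinuousLinearMap.adjoint_inner_left, ContinuousLinearMap.adjoint_inner_left]
  rfl

end Pairs

/-! ### Second-order cones -/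

section SecondOrderCone

theorem inner_nonneg_of_mem_secondOrderCone {r : ℕ} {x y : Euc (r + 1)}
    (hx : x ∈ secondOrderCone r) (hy : y ∈ secondOrderCone r) : 0 ≤ inner ℝ x y := by
  set x' : Euc r := WithLp.toLp 2 (fun j : Fin r => x j.succ)
  set y' : Euc r := WithLp.toLp 2 (fun j : Fin r => y j.succ)
  have h : inner ℝ x y = x 0 * y 0 + inner ℝ x' y' := by
    simp only [PiLp.inner_apply, Fin.sum_univ_succ]
    simp [x', y', mul_comm]
  have hx' : ‖x'‖ ≤ x 0 := hx
  have hy' : ‖y'‖ ≤ y 0 := hy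
  have h1 := (abs_le.1 (abs_real_inner_le_norm x' y')).1
  have h2 := mul_le_mul hx' hy' (norm_nonneg _) ((norm_nonneg _).trans hx')
  linarith

theorem isClosed_secondOrderCone (r : ℕ) : IsClosed (secondOrderCone r) :=
  isClosed_le (by fun_prop) (by fun_prop)

theorem isClosed_socComplementaritySet (r : ℕ) : IsClosed (socComplementaritySet r) := by
  have h1 : Continuous fun u : WithLp 2 (Euc (r + 1) × Euc (r + 1)) => u.fst := by fun_prop
  have h2 : Continuous fun u : WithLp 2 (Euc (r + 1) × Euc (r + 1)) => u.snd := by fun_prop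
  exact ((isClosed_secondOrderCone r).preimage h1).inter
    (((isClosed_secondOrderCone r).preimage h2).inter
      (isClosed_eq (h1.inner h2) continuous_const))

/-- Inner products within each cone are nonnegative, so the total inner product vanishes only if
every block term does. -/
theorem mem_blockPairSet_socComplementaritySet_iff {J : ℕ} {r : Fin J → ℕ} (x y : BlockSpace r) :
    l2pair x y ∈ blockPairSet (fun i => socComplementaritySet (r i)) ↔
      x ∈ productCone r ∧ y ∈ productCone r ∧ inner ℝ x y = 0 := by
  constructor
  · intro h
    refine ⟨fun i => (h i).1, fun i => (h i).2.1, ?_⟩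
    rw [PiLp.inner_apply]
    exact Finset.sum_eq_zero fun i _ => (h i).2.2
  · rintro ⟨hx, hy, hxy⟩ i
    rw [PiLp.inner_apply, Finset.sum_eq_zero_iff_of_nonneg
      fun i _ => inner_nonneg_of_mem_secondOrderCone (hx i) (hy i)] at hxy
    exact ⟨hx i, hy i, hxy i (Finset.mem_univ i)⟩

end SecondOrderCone

/-! ### Components of the constraint set -/

section ConstraintSet

variable {p q s : ℕ}

theorem mem_blockPairSet_complementarityCone_iff (x y : Euc s) :
    l2pair x y ∈ blockPairSet (fun _ : Fin s => complementarityCone) ↔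
      (∀ i, 0 ≤ x i) ∧ (∀ i, 0 ≤ y i) ∧ inner ℝ x y = 0 := by
  have hin : inner ℝ x y = ∑ i, x i * y i := by
    rw [PiLp.inner_apply]
    exact Finset.sum_congr rfl fun i _ => by simp [mul_comm]
  rw [hin]
  constructor
  · intro h
    exact ⟨fun i => (h i).1, fun i => (h i).2.1, Finset.sum_eq_zero fun i _ => (h i).2.2⟩
  · rintro ⟨hx, hy, hxy⟩ i
    rw [Finset.sum_eq_zero_iff_of_nonneg fun i _ => mul_nonneg (hx i) (hy i)] at hxy
    exact ⟨hx i, hy i, hxy i (Finset.mem_univ i)⟩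

theorem mem_constraintSet_iff (u : ConstraintSpace p q s) :
    u ∈ constraintSet p q s ↔ (∀ i, u.fst i ≤ 0) ∧ u.snd.fst = 0 ∧
      u.snd.snd ∈ blockPairSet (fun _ : Fin s => complementarityCone) := by
  rw [show u.snd.snd = l2pair u.snd.snd.fst u.snd.snd.snd from rfl,
    mem_blockPairSet_complementarityCone_iff]
  rfl

theorem isClosed_constraintSet : IsClosed (constraintSet p q s) := by
  have h : constraintSet p q s = {u | ∀ i, u.fst i ≤ 0} ∩ ({u | u.snd.fst = 0} ∩
      (fun u : ConstraintSpace p q s => u.snd.snd) ⁻¹'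
        blockPairSet (fun _ : Fin s => complementarityCone)) :=
    Set.ext mem_constraintSet_iff
  rw [h]
  refine IsClosed.inter ?_ ((isClosed_eq (by fun_prop) continuous_const).inter
    ((isClosed_blockPairSet fun _ => isClosed_complementarityCone).preimage (by fun_prop)))
  rw [Set.ofPred_forall]
  exact isClosed_iInter fun i => isClosed_le (by fun_prop) continuous_const

/-- The `i`-th inequality component of a point of the constraint space. -/
noncomputable def inequalityProj (i : Fin p) : ConstraintSpace p q s →L[ℝ] ℝ :=
  EuclideanSpace.proj i ∘L WithLp.fstL 2 ℝ (Euc p) (WithLp 2 (Euc q × WithLp 2 (Euc s × Euc s)))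

/-- The complementarity component of a point of the constraint space. -/
noncomputable def complementarityProj : ConstraintSpace p q s →L[ℝ] WithLp 2 (Euc s × Euc s) :=
  WithLp.sndL 2 ℝ (Euc q) (WithLp 2 (Euc s × Euc s)) ∘L
    WithLp.sndL 2 ℝ (Euc p) (WithLp 2 (Euc q × WithLp 2 (Euc s × Euc s)))

theorem inequalityProj_mem_directionalNormalCone {z d v : ConstraintSpace p q s}
    (hv : v ∈ directionalNormalCone (constraintSet p q s) z d) (i : Fin p) :
    v.fst i ∈ directionalNormalCone (Set.Iic (0 : ℝ)) (z.fst i) (d.fst i) := by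
  refine map_mem_directionalNormalCone (inequalityProj i)
    (fun a => l2pair (EuclideanSpace.single i a) 0) (fun a => le_of_eq ?_)
    (fun v a => ?_) (fun u hu => hu.1 i) (fun u hu a ha => ?_) hv
  · simp
  · simp [WithLp.prod_inner_apply, inequalityProj, EuclideanSpace.inner_single_right]
  · rw [mem_constraintSet_iff] at hu ⊢
    refine ⟨fun k => ?_, ?_, ?_⟩
    · by_cases hk : k = i
      · subst hk
        have ha : a ≤ 0 := ha
        simpa [inequalityProj] using ha
      · simpa [hk] using hu.1 k
    · simpa using hu.2.1
    · simpa using hu.2.2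

theorem complementarityProj_mem_directionalNormalCone {z d v : ConstraintSpace p q s}
    (hv : v ∈ directionalNormalCone (constraintSet p q s) z d) :
    v.snd.snd ∈ directionalNormalCone (blockPairSet fun _ : Fin s => complementarityCone)
      z.snd.snd d.snd.snd := by
  refine map_mem_directionalNormalCone complementarityProj
    (fun a => l2pair 0 (l2pair 0 a)) (fun a => le_of_eq ?_)
    (fun v a => ?_) (fun u hu => ((mem_constraintSet_iff u).1 hu).2.2) (fun u hu a ha => ?_) hv
  · simp [WithLp.prod_norm_eq_of_L2 (α := Euc p), WithLp.prod_norm_eq_of_L2 (α := Euc q)]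
  · rw [WithLp.prod_inner_apply (E := Euc p), WithLp.prod_inner_apply (E := Euc q)]
    simp [complementarityProj]
  · rw [mem_constraintSet_iff] at hu ⊢
    refine ⟨fun k => ?_, ?_, ?_⟩
    · simpa using hu.1 k
    · simpa using hu.2.1
    · simpa [complementarityProj] using ha

theorem inequalityProj_mem_tangentConeB {z d : ConstraintSpace p q s}
    (hd : d ∈ tangentConeB (constraintSet p q s) z) (i : Fin p) :
    d.fst i ∈ tangentConeB (Set.Iic (0 : ℝ)) (z.fst i) :=
  map_mem_tangentConeB (inequalityProj i) (fun _ hu => hu.1 i) hd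

theorem equality_eq_zero_of_mem_tangentConeB {z d : ConstraintSpace p q s} (hz : z.snd.fst = 0)
    (hd : d ∈ tangentConeB (constraintSet p q s) z) : d.snd.fst = 0 := by
  have h1 : d.snd.fst ∈ tangentConeB {0} z.snd.fst :=
    map_mem_tangentConeB
      (WithLp.fstL 2 ℝ (Euc q) (WithLp 2 (Euc s × Euc s)) ∘L
        WithLp.sndL 2 ℝ (Euc p) (WithLp 2 (Euc q × WithLp 2 (Euc s × Euc s))))
      (fun u hu => hu.2.1) hd
  rw [hz] at h1
  exact tangentConeB_zero_subset_of_isClosed_cone isClosed_singleton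
    (fun t _ x hx => by rw [Set.mem_singleton_iff.1 hx, smul_zero]; rfl) h1

theorem complementarity_mem_tangentConeB {z d : ConstraintSpace p q s}
    (hd : d ∈ tangentConeB (constraintSet p q s) z) (i : Fin s) :
    l2pair (d.snd.snd.fst i) (d.snd.snd.snd i) ∈
      tangentConeB complementarityCone (l2pair (z.snd.snd.fst i) (z.snd.snd.snd i)) :=
  map_mem_tangentConeB (blockPair (V := fun _ : Fin s => ℝ) i ∘L complementarityProj)
    (fun u hu => ((mem_constraintSet_iff u).1 hu).2.2 i) hd

end ConstraintSet

/-! ### The complementarity system -/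

section System

variable {n p q s J : ℕ} {r : Fin J → ℕ} {g : Euc n → Euc p} {h : Euc n → Euc q}
  {φ ψ : Euc n → Euc s} {G H : Euc n → BlockSpace r}

theorem solutionSet_eq :
    solutionSet g h φ ψ G H = {z | constraintMap g h φ ψ z ∈ constraintSet p q s ∧
      l2pair (G z) (H z) ∈ blockPairSet (fun i => socComplementaritySet (r i))} := by
  ext z
  rw [Set.mem_ofPred_eq, mem_blockPairSet_socComplementaritySet_iff, and_comm]
  rfl

theorem infDist_constraintSet_le (z : Euc n) :
    Metric.infDist (constraintMap g h φ ψ z) (constraintSet p q s) ≤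
      ‖h z‖ + ‖(WithLp.toLp 2 (fun i => max 0 (g z i)) : Euc p)‖ +
        ∑ i, Metric.infDist (l2pair (φ z i) (ψ z i)) complementarityCone := by
  obtain ⟨v, hv, hvd⟩ := infDist_blockPairSet_le (fun _ : Fin s => isClosed_complementarityCone)
    (fun _ => ⟨0, le_rfl, le_rfl, mul_zero _⟩) (l2pair (φ z) (ψ z))
  -- Componentwise projection: the residuals left over are `g₊`, `h` and the blockwise distances to
  -- the complementarity cone.
  let u : ConstraintSpace p q s :=
    l2pair (WithLp.toLp 2 fun i => min 0 (g z i)) (l2pair 0 v)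
  have hu : u ∈ constraintSet p q s :=
    (mem_constraintSet_iff u).2 ⟨fun i => min_le_left _ _, rfl, hv⟩
  refine (Metric.infDist_le_dist_of_mem hu).trans ?_
  rw [dist_eq_norm]
  have hsub : constraintMap g h φ ψ z - u =
      l2pair (WithLp.toLp 2 (fun i => max 0 (g z i))) (l2pair (h z) (l2pair (φ z) (ψ z) - v)) := by
    have h1 : g z - WithLp.toLp 2 (fun i => min 0 (g z i)) =
        WithLp.toLp 2 (fun i => max 0 (g z i)) := by
      ext i
      have := min_add_max 0 (g z i)
      simp only [PiLp.sub_apply]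
      linarith
    rw [← h1, ← sub_zero (h z)]
    rfl
  rw [hsub]
  have h1 := norm_l2pair_le (WithLp.toLp 2 (fun i => max 0 (g z i)) : Euc p)
    (l2pair (h z) (l2pair (φ z) (ψ z) - v))
  have h2 := norm_l2pair_le (h z) (l2pair (φ z) (ψ z) - v)
  have h3 : ‖l2pair (φ z) (ψ z) - v‖ ≤
    ∑ i, Metric.infDist (l2pair (φ z i) (ψ z i)) complementarityCone := hvd
  linarith

/-- Only this direction is needed: failure of the bound for the larger residual implies failure for
the two product distances. -/
theorem infDist_add_infDist_le_errorResidual (z : Euc n) :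
    Metric.infDist (constraintMap g h φ ψ z) (constraintSet p q s) +
      Metric.infDist (l2pair (G z) (H z)) (blockPairSet fun i => socComplementaritySet (r i)) ≤
      errorResidual g h φ ψ G H z := by
  refine add_le_add (infDist_constraintSet_le z) ?_
  obtain ⟨v, hv, hvd⟩ := infDist_blockPairSet_le
    (fun i : Fin J => isClosed_socComplementaritySet (r i))
    (fun i => ⟨0, by simp [socComplementaritySet, secondOrderCone, ← Pi.zero_def]⟩)
    (l2pair (G z) (H z))
  refine (Metric.infDist_le_dist_of_mem hv).trans ?_
  rw [dist_eq_norm]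
  exact hvd

theorem contDiff_constraintMap (hg : ContDiff ℝ 1 g) (hh : ContDiff ℝ 1 h) (hφ : ContDiff ℝ 1 φ)
    (hψ : ContDiff ℝ 1 ψ) : ContDiff ℝ 1 (constraintMap g h φ ψ) :=
  contDiff_l2pair hg (contDiff_l2pair hh (contDiff_l2pair hφ hψ))

theorem fderiv_constraintMap_apply (hg : ContDiff ℝ 1 g) (hh : ContDiff ℝ 1 h)
    (hφ : ContDiff ℝ 1 φ) (hψ : ContDiff ℝ 1 ψ) (z w : Euc n) :
    fderiv ℝ (constraintMap g h φ ψ) z w = l2pair (fderiv ℝ g z w)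
      (l2pair (fderiv ℝ h z w) (l2pair (fderiv ℝ φ z w) (fderiv ℝ ψ z w))) := by
  have h2 := contDiff_l2pair hφ hψ
  have h1 := contDiff_l2pair hh h2
  rw [← fderiv_l2pair_apply (hφ.differentiable one_ne_zero z) (hψ.differentiable one_ne_zero z),
    ← fderiv_l2pair_apply (hh.differentiable one_ne_zero z) (h2.differentiable one_ne_zero z),
    ← fderiv_l2pair_apply (hg.differentiable one_ne_zero z) (h1.differentiable one_ne_zero z)]
  rfl

theorem adjoint_fderiv_constraintMap (hg : ContDiff ℝ 1 g) (hh : ContDiff ℝ 1 h)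
    (hφ : ContDiff ℝ 1 φ) (hψ : ContDiff ℝ 1 ψ) (z : Euc n) (m : ConstraintSpace p q s) :
    (fderiv ℝ (constraintMap g h φ ψ) z).adjoint m = (fderiv ℝ g z).adjoint m.fst +
      (fderiv ℝ h z).adjoint m.snd.fst + (fderiv ℝ φ z).adjoint m.snd.snd.fst +
      (fderiv ℝ ψ z).adjoint m.snd.snd.snd := by
  have h2 := contDiff_l2pair hφ hψ
  have h1 := contDiff_l2pair hh h2
  rw [add_assoc, ← adjoint_fderiv_l2pair (hφ.differentiable one_ne_zero z)
      (hψ.differentiable one_ne_zero z), add_assoc,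
    ← adjoint_fderiv_l2pair (hh.differentiable one_ne_zero z) (h2.differentiable one_ne_zero z),
    ← adjoint_fderiv_l2pair (hg.differentiable one_ne_zero z) (h1.differentiable one_ne_zero z)]
  rfl

theorem mem_linearizedCone_of_tangent (hg : ContDiff ℝ 1 g) (hh : ContDiff ℝ 1 h)
    (hφ : ContDiff ℝ 1 φ) (hψ : ContDiff ℝ 1 ψ) {zs w : Euc n}
    (hzs : zs ∈ solutionSet g h φ ψ G H)
    (hP : fderiv ℝ (constraintMap g h φ ψ) zs w ∈
      tangentConeB (constraintSet p q s) (constraintMap g h φ ψ zs))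
    (hQ : l2pair (fderiv ℝ G zs w) (fderiv ℝ H zs w) ∈
      tangentConeB (blockPairSet fun i => socComplementaritySet (r i)) (l2pair (G zs) (H zs))) :
    w ∈ linearizedCone g h φ ψ G H zs := by
  rw [fderiv_constraintMap_apply hg hh hφ hψ] at hP
  obtain ⟨-, -, hh0, hφ0, hψ0, hφψ⟩ := hzs
  have hΘ : ∀ i, l2pair (φ zs i) (ψ zs i) ∈ complementarityCone :=
    (mem_blockPairSet_complementarityCone_iff (φ zs) (ψ zs)).2 ⟨hφ0, hψ0, hφψ⟩
  have hT : ∀ i, l2pair (fderiv ℝ φ zs w i) (fderiv ℝ ψ zs w i) ∈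
      tangentConeB complementarityCone (l2pair (φ zs i) (ψ zs i)) := fun i =>
    complementarity_mem_tangentConeB hP i
  have hTQ : ∀ i, l2pair (fderiv ℝ G zs w i) (fderiv ℝ H zs w i) ∈
      tangentConeB (socComplementaritySet (r i)) (l2pair (G zs i) (H zs i)) := fun i =>
    blockPair_mem_tangentConeB hQ i
  refine ⟨fun i hi => ?_, fun i => ?_, fun i hi => ?_, fun i hi => ?_, fun i hi hi' => ?_, hTQ⟩
  · have h1 := inequalityProj_mem_tangentConeB hP i
    change fderiv ℝ g zs w i ∈ tangentConeB (Set.Iic (0 : ℝ)) (g zs i) at h1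
    rw [hi] at h1
    exact tangentConeB_zero_subset_of_isClosed_cone isClosed_Iic
      (fun t ht x hx => mul_nonpos_of_nonneg_of_nonpos ht.le hx) h1
  · have h1 : fderiv ℝ h zs w = 0 := equality_eq_zero_of_mem_tangentConeB
      (z := constraintMap g h φ ψ zs) hh0 hP
    rw [h1]
    rfl
  · exact fst_eq_zero_of_mem_tangentConeB (a := l2pair (φ zs i) (ψ zs i))
      (d := l2pair (fderiv ℝ φ zs w i) (fderiv ℝ ψ zs w i)) (lt_of_le_of_ne (hψ0 i) hi.symm)
      ((mul_eq_zero.1 (hΘ i).2.2).resolve_right hi) (hT i)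
  · exact snd_eq_zero_of_mem_tangentConeB (a := l2pair (φ zs i) (ψ zs i))
      (d := l2pair (fderiv ℝ φ zs w i) (fderiv ℝ ψ zs w i)) (lt_of_le_of_ne (hφ0 i) hi.symm)
      ((mul_eq_zero.1 (hΘ i).2.2).resolve_left hi) (hT i)
  · have h1 := hT i
    rw [hi, hi'] at h1
    have h2 : l2pair (fderiv ℝ φ zs w i) (fderiv ℝ ψ zs w i) ∈ complementarityCone :=
      tangentConeB_zero_subset_of_isClosed_cone isClosed_complementarityCone
        smul_mem_complementarityCone h1
    exact ⟨h2.1, h2.2.1, h2.2.2⟩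

/-- The direction is kept only for the biactive complementarity pairs and the second-order cone
blocks; elsewhere the weaker limiting normality suffices. -/
theorem isDirectionalMultiplier_of_normal (hg : ContDiff ℝ 1 g) (hh : ContDiff ℝ 1 h)
    (hφ : ContDiff ℝ 1 φ) (hψ : ContDiff ℝ 1 ψ) (hG : ContDiff ℝ 1 G) (hH : ContDiff ℝ 1 H)
    {zs w : Euc n} (hzs : zs ∈ solutionSet g h φ ψ G H)
    {m : ConstraintSpace p q s} {l : WithLp 2 (BlockSpace r × BlockSpace r)}
    (hm : m ∈ directionalNormalCone (constraintSet p q s) (constraintMap g h φ ψ zs)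
      (fderiv ℝ (constraintMap g h φ ψ) zs w))
    (hl : l ∈ directionalNormalCone (blockPairSet fun i => socComplementaritySet (r i))
      (l2pair (G zs) (H zs)) (l2pair (fderiv ℝ G zs w) (fderiv ℝ H zs w)))
    (hsum : (fderiv ℝ (fun z => l2pair (G z) (H z)) zs).adjoint l +
      (fderiv ℝ (constraintMap g h φ ψ) zs).adjoint m = 0) :
    IsDirectionalMultiplier g h φ ψ G H zs w m.fst m.snd.fst m.snd.snd.fst m.snd.snd.snd
      l.fst l.snd := by
  rw [fderiv_constraintMap_apply hg hh hφ hψ] at hm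
  rw [adjoint_fderiv_constraintMap hg hh hφ hψ, adjoint_fderiv_l2pair
    (hG.differentiable one_ne_zero zs) (hH.differentiable one_ne_zero zs), add_comm,
    ← add_assoc] at hsum
  obtain ⟨-, hg0, -, hφ0, hψ0, -⟩ := hzs
  have hN : ∀ i, l2pair (m.snd.snd.fst i) (m.snd.snd.snd i) ∈
      directionalNormalCone complementarityCone (l2pair (φ zs i) (ψ zs i))
        (l2pair (fderiv ℝ φ zs w i) (fderiv ℝ ψ zs w i)) := fun i =>
    blockPair_mem_directionalNormalCone (complementarityProj_mem_directionalNormalCone hm) i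
  have hNg := fun i => directionalNormalCone_subset_limitingNormalCone
    (inequalityProj_mem_directionalNormalCone hm i)
  refine ⟨hsum, fun i => nonneg_of_mem_limitingNormalCone_Iic (hNg i),
    fun i hi => eq_zero_of_mem_limitingNormalCone_Iic (lt_of_le_of_ne (hg0 i) hi) (hNg i),
    fun i hi => fst_eq_zero_of_mem_limitingNormalCone (a := l2pair (φ zs i) (ψ zs i))
      (lt_of_le_of_ne (hφ0 i) hi.symm)
      (directionalNormalCone_subset_limitingNormalCone (hN i)),
    fun i hi => snd_eq_zero_of_mem_limitingNormalCone (a := l2pair (φ zs i) (ψ zs i))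
      (lt_of_le_of_ne (hψ0 i) hi.symm)
      (directionalNormalCone_subset_limitingNormalCone (hN i)),
    fun i hi hi' => ?_, fun i => blockPair_mem_directionalNormalCone hl i⟩
  have h1 := hN i
  rw [hi, hi'] at h1
  exact mem_limitingNormalCone_of_cone smul_mem_complementarityCone h1

end System

theorem mainTheorem5 {n p q s J : ℕ} {r : Fin J → ℕ}
    (g : Euc n → Euc p) (h : Euc n → Euc q) (φ ψ : Euc n → Euc s) (G H : Euc n → BlockSpace r)
    (hg : ContDiff ℝ 1 g) (hh : ContDiff ℝ 1 h) (hφ : ContDiff ℝ 1 φ) (hψ : ContDiff ℝ 1 ψ)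
    (hG : ContDiff ℝ 1 G) (hH : ContDiff ℝ 1 H)
    (zs : Euc n) (hzs : zs ∈ solutionSet g h φ ψ G H)
    (hCS : MetricallySubregularAt (constraintMap g h φ ψ) (constraintSet p q s) zs)
    (hL : linearizedCone g h φ ψ G H zs = {0} ∨
      (linearizedCone g h φ ψ G H zs ≠ {0} ∧
        ∀ w ∈ linearizedCone g h φ ψ G H zs, w ≠ 0 →
          ∀ (lg : Euc p) (lh : Euc q) (lφ lψ : Euc s) (lG lH : BlockSpace r),
            IsDirectionalMultiplier g h φ ψ G H zs w lg lh lφ lψ lG lH →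
            lG = 0 ∧ lH = 0)) :
    ∃ κ : ℝ, 0 < κ ∧ ∃ δ : ℝ, 0 < δ ∧ ∀ z ∈ Metric.ball zs δ,
      Metric.infDist z (solutionSet g h φ ψ G H) ≤ κ * errorResidual g h φ ψ G H z := by
  by_contra! hfail
  have hQzs := hzs
  rw [solutionSet_eq] at hQzs
  obtain ⟨w, l, m, hw, hl0, hl, hm, hsum⟩ := exists_directional_multipliers
    (contDiff_l2pair hG hH) (contDiff_constraintMap hg hh hφ hψ)
    (isClosed_blockPairSet fun i => isClosed_socComplementaritySet (r i))
    isClosed_constraintSet hQzs.2 hCS fun κ hκ δ hδ => by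
      obtain ⟨z, hz, hlt⟩ := hfail κ hκ δ hδ
      rw [solutionSet_eq] at hlt
      exact ⟨z, hz, (mul_le_mul_of_nonneg_left
        (infDist_add_infDist_le_errorResidual z) hκ.le).trans_lt hlt⟩
  rw [fderiv_l2pair_apply (hG.differentiable one_ne_zero zs)
    (hH.differentiable one_ne_zero zs)] at hl
  have hwL : w ∈ linearizedCone g h φ ψ G H zs := mem_linearizedCone_of_tangent hg hh hφ hψ hzs
    (mem_tangentConeB_of_mem_directionalNormalCone hm)
    (mem_tangentConeB_of_mem_directionalNormalCone hl)
  -- The direction `w ≠ 0` already contradicts a trivial linearized cone; otherwise the multiplier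
  -- condition forces `l = 0`.
  rcases hL with hL | ⟨-, hL⟩
  · rw [hL] at hwL
    exact hw hwL
  · obtain ⟨h1, h2⟩ := hL w hwL hw _ _ _ _ _ _
      (isDirectionalMultiplier_of_normal hg hh hφ hψ hG hH hzs hm hl hsum)
    refine hl0 ?_
    rw [show l = l2pair l.fst l.snd from rfl, h1, h2]
    rfl
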